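/- Let $n\in\mathbb N$, $0<\alpha\le 1$, $0<T<\infty$, and let $\varphi\in C^1[0,T]$ with $\varphi'>0$ on $[0,T]$. For $a>0$ put $$I_{0+}^{a,\varphi}f(t)=\frac1{\Gamma(a)}\int_0^t\varphi'(s)(\varphi(t)-\varphi(s))^{a-1}f(s)\,ds,\qquad I_{0+}^{0,\varphi}f=f,$$ $$D_{0+}^{\alpha,\varphi}f(t)=\frac1{\varphi'(t)}\frac{d}{dt}\big(I_{0+}^{1-\alpha,\varphi}f\big)(t),\qquad {}^{C}\partial_t^{\alpha,\varphi}f=D_{0+}^{\alpha,\varphi}\big[f-f(0)\big].$$ Let $\Theta$ be a real continuous function on $[0,T]$ with $\Theta>0$ on $(0,T]$, let $\Omega\subset\mathbb R^n$ be open and bounded, let $q\in\Omega$, and let $w_1:\mathbb R^n\to\mathbb C$. Consider the complexified Clifford algebra of $\mathbb R^{n+1,1}$ with anticommuting generators $e_1,\dots,e_n,e_+,e_-$, $e_k^2=-1$, $e_+^2=1$, $e_-^2=-1$, and put $\mathfrak f=\frac12(e_+-e_-)$, $\mathfrak f^+=\frac12(e_++e_-)$, $D_x=\sum_{k=1}^n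 e_k\partial_{x_k}$. For $g:\mathbb R^n\to\mathbb C$ consider the following two problems. (D) The Dirac type Cauchy problem for a Clifford-valued $W$: $$\big(\Theta^{1/2}(t)D_x+\mathfrak f\,{}^{C}\partial_t^{\alpha,\varphi}+\mathfrak f^+\big)W(x,t)=0\quad(x\in\mathbb R^n,\ 0<t\le T),\qquad \mathfrak f\,W(x,0)=\mathfrak f\,g(x).$$ (H) The transformed scalar Cauchy problem for a complex-valued $u$: $${}^{C}\partial_t^{\alpha,\varphi}u(x,t)=\Theta(t)\Delta_xu(x,t)\quad(x\in\mathbb R^n,\ 0<t\le T),\qquad u(x,0)=g(x).$$ Spatial derivatives are taken in the sense of distributions: for every real $\psi\in C_c^\infty(\mathbb R^n)$ the equation is tested with $\psi$ in $x$, and the modified derivative in $t$ of the resulting function of $t$ is required to exist on $(0,T]$ (one-sided at $T$). For Clifford-valued functions everything is understood componentwise. Solutions are taken in the class where $u$ (respectively every component of $\mathfrak f\,W$) is continuous on $\mathbb R^n\times[0,T]$ and integrable in $x$ with $\sup_{0\le t\le T}\|u(\cdot,t)\|_{L^1(\mathbb R^n)}<\infty$; the components of $W(\cdot,t)$, $0<t\le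 T$, are locally integrable. Let the following conditions be satisfied: 1. $\max_{[0,T]}|\Theta|\cdot I_{0+}^{\alpha,\varphi}e^{\nu t}\le Ce^{\nu t}$ on $[0,T]$ for some $\nu>0$ and some constant $0<C<1$ independent of $t$; 2. $w_1\in C^2(\Omega)\cap C^1(\overline\Omega)$ and $\operatorname{supp}(w_1)\subset\Omega$; 3. $h_2\in C^1[0,T]$ and $h_2(t)\ne0$ for all $t\in(0,T)$; 4. there is $K>0$ such that $D_{0+}^{\alpha,\varphi}h_1(t)/h_2(t)$ is real and $\ge K$ for all $t\in(0,T]$. Here $h_1,h_2$ are the observations at $q$ in one of the following two senses: (a) $W$ and $V$ solve (D) with $g=w_1$ and $g=\Delta w_1$ respectively, and $\mathfrak f\,W(q,t)-\mathfrak f\,w_1(q)=\mathfrak f\,h_1(t)$, $\mathfrak f\,V(q,t)=\mathfrak f\,h_2(t)$ for $0<t\le T$; (b) $w$ and $v$ solve (H) with $g=w_1$ and $g=\Delta w_1$ respectively, and $w(q,t)-w_1(q)=h_1(t)$, $v(q,t)=h_2(t)$ for $0<t\le T$. Then, in either case, the diffusivity is recovered by $$\Theta(t)=\frac{D_{0+}^{\alpha,\varphi}h_1(t)}{h_2(t)},\qquad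 t\in(0,T].$$ -/

import Mathlib

open Set MeasureTheory
open scoped ComplexOrder

noncomputable section

/-! ### Fractional calculus with respect to another function -/

section Fractional

variable {E : Type*} [NormedAddCommGroup E] [NormedSpace ℝ E]

/-- The derivative `φ'` of `φ` on `[0,T]` (one-sided at the end points). -/
def dphi (T : ℝ) (φ : ℝ → ℝ) (t : ℝ) : ℝ := derivWithin φ (Icc 0 T) t

/-- `φ ∈ C¹[0,T]` with `φ' > 0` on `[0,T]`. -/
structure IsTimeScale (T : ℝ) (φ : ℝ → ℝ) : Prop where
  contDiffOn : ContDiffOn ℝ 1 φ (Icc 0 T)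
  dphi_pos : ∀ t ∈ Icc 0 T, 0 < dphi T φ t

/-- The left-sided Riemann-Liouville fractional integral of order `a ≥ 0` with respect to `φ`,
`I_{0+}^{a,φ} f (t) = Γ(a)⁻¹ ∫₀ᵗ φ'(s) (φ(t) - φ(s))^(a-1) f(s) ds`; the integral of order `0` is
the identity. -/
def rlIntegral (T : ℝ) (φ : ℝ → ℝ) (a : ℝ) (f : ℝ → E) (t : ℝ) : E :=
  if a = 0 then f t
  else (Real.Gamma a)⁻¹ • ∫ s in (0 : ℝ)..t, (dphi T φ s * (φ t - φ s) ^ (a - 1)) • f s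

/-- The left-sided Riemann-Liouville fractional derivative of order `0 < α ≤ 1` with respect to
`φ`, `D_{0+}^{α,φ} f (t) = φ'(t)⁻¹ (d/dt) (I_{0+}^{1-α,φ} f) (t)`. -/
def rlDeriv (T : ℝ) (φ : ℝ → ℝ) (α : ℝ) (f : ℝ → E) (t : ℝ) : E :=
  (dphi T φ t)⁻¹ • derivWithin (rlIntegral T φ (1 - α) f) (Icc 0 T) t

/-- The modified (Caputo type) derivative of order `0 < α ≤ 1`,
`ᶜD_{0+}^{α,φ} f (t) = D_{0+}^{α,φ} [f - f(0)] (t)`, exists and has the value `d`. -/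
def HasCaputoDeriv (T : ℝ) (φ : ℝ → ℝ) (α : ℝ) (f : ℝ → E) (d : E) (t : ℝ) : Prop :=
  DifferentiableWithinAt ℝ (rlIntegral T φ (1 - α) (fun s => f s - f 0)) (Icc 0 T) t ∧
    rlDeriv T φ α (fun s => f s - f 0) t = d

end Fractional

/-! ### The transformed (scalar) Cauchy problem -/

/-- The space `ℝⁿ`. -/
abbrev Space (n : ℕ) : Type := EuclideanSpace ℝ (Fin n)

/-- Test functions: real smooth functions on `ℝⁿ` with compact support. -/
def IsTest {n : ℕ} (ψ : Space n → ℝ) : Prop :=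
  ContDiff ℝ (⊤ : ℕ∞) ψ ∧ HasCompactSupport ψ

/-- The partial derivative `∂ψ/∂x_k`. -/
def partialDeriv {n : ℕ} (k : Fin n) (ψ : Space n → ℝ) (x : Space n) : ℝ :=
  fderiv ℝ ψ x (EuclideanSpace.single k 1)

/-- The class of fields in which the Cauchy problems are considered: `u` is continuous on
`ℝⁿ × [0,T]`, every `u(·,t)` is integrable, and the `L¹`-norms are bounded uniformly in `t`. -/
def IsAdmissible {n : ℕ} (T : ℝ) (u : Space n → ℝ → ℂ) : Prop :=
  ContinuousOn (fun p : Space n × ℝ => u p.1 p.2) (univ ×ˢ Icc 0 T) ∧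
    (∀ t ∈ Icc 0 T, Integrable (fun x => u x t)) ∧
    ∃ M : ℝ, ∀ t ∈ Icc 0 T, ∫ x, ‖u x t‖ ≤ M

/-- `u` is an admissible solution of `ᶜ∂ₜ^{α,φ} u = Θ(t) Δₓ u` on `ℝⁿ × (0,T]`, `u(·,0) = g`.
The Laplacian is taken in the sense of distributions on `ℝⁿ`. -/
structure SolvesHeat {n : ℕ} (α T : ℝ) (φ Θ : ℝ → ℝ) (g : Space n → ℂ)
    (u : Space n → ℝ → ℂ) : Prop where
  admissible : IsAdmissible T u
  initial : ∀ x, u x 0 = g x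
  equation : ∀ ψ : Space n → ℝ, IsTest ψ → ∀ t ∈ Ioc 0 T,
    HasCaputoDeriv T φ α (fun s => ∫ x, (ψ x : ℂ) * u x s)
      ((Θ t : ℂ) * ∫ x, ((Laplacian.laplacian ψ x : ℝ) : ℂ) * u x t) t

/-! ### The Cauchy problem for the fractional Dirac type operator -/

/-- The quadratic form on `ℂ^(n+2)` with `e_k² = -1` (`k = 1, …, n`), `e_+² = 1`, `e_-² = -1`;
`Sum.inr 0` is the index of `e_+` and `Sum.inr 1` that of `e_-`. -/
def wittForm (n : ℕ) : QuadraticForm ℂ (Fin n ⊕ Fin 2 → ℂ) :=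
  QuadraticMap.weightedSumSquares ℂ (Sum.elim (fun _ : Fin n => (-1 : ℂ)) ![1, -1])

/-- The complexified Clifford algebra of `ℝ^{n+1,1}`. -/
abbrev Cliff (n : ℕ) : Type := CliffordAlgebra (wittForm n)

/-- The generator with index `i`. -/
def cliffGen (n : ℕ) (i : Fin n ⊕ Fin 2) : Cliff n :=
  CliffordAlgebra.ι (wittForm n) (Pi.single i 1)

/-- The generator `e_k`, `k = 1, …, n`. -/
def cliffE {n : ℕ} (k : Fin n) : Cliff n := cliffGen n (Sum.inl k)

/-- The Witt basis element `𝔣 = (e_+ - e_-) / 2`. -/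
def wittF (n : ℕ) : Cliff n := (1 / 2 : ℂ) • (cliffGen n (Sum.inr 0) - cliffGen n (Sum.inr 1))

/-- The Witt basis element `𝔣⁺ = (e_+ + e_-) / 2`. -/
def wittFplus (n : ℕ) : Cliff n :=
  (1 / 2 : ℂ) • (cliffGen n (Sum.inr 0) + cliffGen n (Sum.inr 1))

/-- The Clifford-valued field `W` solves
`(Θ^{1/2}(t) Dₓ + 𝔣 ᶜ∂ₜ^{α,φ} + 𝔣⁺) W = 0` on `ℝⁿ × (0,T]`, `Dₓ = ∑ e_k ∂_k`, with initial datum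
`g`. All analytic notions are taken componentwise, that is, after composition with an arbitrary
linear functional `ℓ` on the Clifford algebra, and `Dₓ` is taken in the sense of distributions on
`ℝⁿ`, so that `∫ ψ ℓ(Dₓ W) dx = - ∑_k ∫ ∂_k ψ ℓ(e_k W) dx`. The initial condition `W(·,0) = g`
enters only through its consequence `𝔣 W(·,0) = 𝔣 g`: only `𝔣 W` is differentiated in time. -/
structure SolvesDirac {n : ℕ} (α T : ℝ) (φ Θ : ℝ → ℝ) (g : Space n → ℂ)
    (W : Space n → ℝ → Cliff n) : Prop where
  locallyIntegrable : ∀ ℓ : Cliff n →ₗ[ℂ] ℂ, ∀ t ∈ Ioc 0 T,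
    LocallyIntegrable (fun x => ℓ (W x t))
  admissible : ∀ ℓ : Cliff n →ₗ[ℂ] ℂ, IsAdmissible T (fun x t => ℓ (wittF n * W x t))
  initial : ∀ x, wittF n * W x 0 = g x • wittF n
  equation : ∀ ℓ : Cliff n →ₗ[ℂ] ℂ, ∀ ψ : Space n → ℝ, IsTest ψ → ∀ t ∈ Ioc 0 T,
    ∃ d : ℂ, HasCaputoDeriv T φ α (fun s => ∫ x, (ψ x : ℂ) * ℓ (wittF n * W x s)) d t ∧
      (Real.sqrt (Θ t) : ℂ) *
          (-∑ k : Fin n, ∫ x, (partialDeriv k ψ x : ℂ) * ℓ (cliffE k * W x t)) +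
        d + (∫ x, (ψ x : ℂ) * ℓ (wittFplus n * W x t)) = 0

end

/-! The point is that the solution `v` with datum `Δw₁` is the Laplacian of the solution `w` with
datum `w₁`. Then `w` satisfies `∂ᵅw = Θ v`, and inverting the time derivative at `x = q` gives `h₁ =
I^α(Θ h₂)`, hence `D^α h₁ = Θ h₂`. The bound in condition 4 excludes `h₂ t = 0`, so one may divide.

Since the equation is only weak, `v = Δw` is proved by Fourier analysis. Pairing with a test
function turns the Cauchy problem into a Volterra equation (`SolvesHeat.volterra_of_isTest`), and
the uniform `L¹` bound extends it to smooth functions with bounded derivatives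
(`SolvesHeat.volterra_of_boundedC2`). For a plane wave `ψ` with `Δψ = cψ`, the quantity `⟨ψ,v⟩ -
c⟨ψ,w⟩` solves a homogeneous Volterra equation, because Green's identity cancels the initial data;
it therefore vanishes (`IsTimeScale.eq_zero_of_volterra`). So the Fourier transforms differ by the
factor `-‖ξ‖²`, Fourier inversion gives `⟨ψ,v⟩ = ⟨Δψ,w⟩` for every test function, and mollifiers at
`q` give the pointwise identity `SolvesHeat.sub_eq_rlIntegral`.

The fractional calculus rests on the substitution `x = φ t - φ 0`, which makes `I^{a,φ}` a
convolution with a power kernel. Associativity of convolution and the Beta integral give `I^a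
I^{1-a} = I^1`, and from it both inversion formulas `IsTimeScale.sub_eq_rlIntegral` and
`IsTimeScale.rlDeriv_eq`.

The Dirac problem reduces to the scalar one because the operator factorizes the heat operator:
multiplying on the left by `𝔣𝔣⁺` and by `e_k𝔣` and eliminating `𝔣𝔣⁺W` leaves the scalar equation for
`𝔣W` (`SolvesDirac.solvesHeat`). -/

open Filter Topology Convolution

/-! ### Convolution with the kernels `x ↦ x ^ (a - 1)` on the half line -/

section PowKernel

/-- The kernel `x ^ (a - 1)` on the positive half line, extended by zero. -/
noncomputable def powKernel (a : ℝ) : ℝ → ℝ := (Ioi 0).indicator (fun x => x ^ (a - 1))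

lemma powKernel_of_pos (a : ℝ) {x : ℝ} (hx : 0 < x) : powKernel a x = x ^ (a - 1) :=
  indicator_of_mem (mem_Ioi.2 hx) _

lemma powKernel_of_nonpos (a : ℝ) {x : ℝ} (hx : x ≤ 0) : powKernel a x = 0 :=
  indicator_of_notMem (notMem_Ioi.2 hx) _

lemma powKernel_nonneg (a x : ℝ) : 0 ≤ powKernel a x :=
  indicator_nonneg (fun _ hx => Real.rpow_nonneg (le_of_lt hx) _) x

lemma measurable_powKernel (a : ℝ) : Measurable (powKernel a) :=
  (measurable_id.pow_const _).indicator measurableSet_Ioi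

lemma integrableOn_powKernel {a : ℝ} (ha : 0 < a) (c : ℝ) :
    IntegrableOn (powKernel a) (Iic c) := by
  rcases le_or_gt c 0 with hc | hc
  · refine (integrableOn_zero (μ := volume)).congr_fun (fun x hx => ?_) measurableSet_Iic
    exact (powKernel_of_nonpos a (le_trans hx hc)).symm
  · have h : IntegrableOn (fun x : ℝ => x ^ (a - 1)) (Ioc 0 c) :=
      (intervalIntegrable_iff_integrableOn_Ioc_of_le hc.le).1
        (intervalIntegral.intervalIntegrable_rpow' (by linarith))
    unfold powKernel
    rw [IntegrableOn, integrable_indicator_iff measurableSet_Ioi, IntegrableOn,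
      Measure.restrict_restrict measurableSet_Ioi]
    exact h

variable {E : Type*} [NormedAddCommGroup E] [NormedSpace ℝ E]

/-- Measurable functions on the line which vanish on the negative half line and are bounded on
every left half line. -/
structure IsCausal (F : ℝ → E) : Prop where
  meas : AEStronglyMeasurable F volume
  zero : ∀ x ≤ 0, F x = 0
  bdd : ∀ c, ∃ M, ∀ x ≤ c, ‖F x‖ ≤ M

omit [NormedSpace ℝ E] in
lemma IsCausal.norm {F : ℝ → E} (hF : IsCausal F) : IsCausal (fun x => ‖F x‖) where
  meas := hF.meas.norm
  zero x hx := by simp [hF.zero x hx]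
  bdd c := by simpa using hF.bdd c

lemma IsCausal.convolutionExistsAt {F : ℝ → E} (hF : IsCausal F) {a : ℝ} (ha : 0 < a) (x : ℝ) :
    ConvolutionExistsAt (powKernel a) F x (ContinuousLinearMap.lsmul ℝ ℝ) volume := by
  obtain ⟨M, hM⟩ := hF.bdd x
  have hm : AEStronglyMeasurable (fun t => F (x - t)) volume :=
    hF.meas.comp_quasiMeasurePreserving
      (quasiMeasurePreserving_sub_left_of_right_invariant volume x)
  have hb : Integrable (fun t => M * (Iic x).indicator (powKernel a) t) :=
    ((integrable_indicator_iff measurableSet_Iic).2 (integrableOn_powKernel ha x)).const_mul M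
  refine hb.mono' ((measurable_powKernel a).aestronglyMeasurable.smul hm) (ae_of_all _ fun t => ?_)
  simp only [ContinuousLinearMap.lsmul_apply, norm_smul, Real.norm_of_nonneg (powKernel_nonneg a t)]
  rcases le_or_gt t 0 with h0 | h0
  · rw [powKernel_of_nonpos a h0]
    by_cases h : t ∈ Iic x <;> simp [h, powKernel_of_nonpos a h0]
  rcases le_or_gt t x with h | h
  · rw [indicator_of_mem (mem_Iic.2 h), mul_comm]
    exact mul_le_mul_of_nonneg_right (hM _ (by linarith)) (powKernel_nonneg a t)
  · rw [hF.zero _ (by linarith), indicator_of_notMem (by simpa using h)]; simp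

lemma convolution_powKernel_eq {F : ℝ → E} (hF : ∀ x ≤ 0, F x = 0) (a x : ℝ) :
    (powKernel a ⋆[ContinuousLinearMap.lsmul ℝ ℝ] F) x =
      ∫ s in Ioo 0 x, (x - s) ^ (a - 1) • F s := by
  rw [convolution_lsmul_swap, ← integral_indicator measurableSet_Ioo]
  refine integral_congr_ae (ae_of_all _ fun t => ?_)
  by_cases ht : t ∈ Ioo 0 x
  · have h : 0 < x - t := by linarith [ht.2]
    simp only [indicator_of_mem ht, powKernel_of_pos a h]
  · simp only [indicator_of_notMem ht]
    rcases le_or_gt t 0 with h0 | h0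
    · simp [hF t h0]
    · have : x ≤ t := by by_contra h; exact ht ⟨h0, not_le.1 h⟩
      simp [powKernel_of_nonpos a (show x - t ≤ 0 by linarith)]

/-- Dominated convergence with the translation placed on `F` and not on the singular kernel.
Continuity of `F` almost everywhere is enough, which admits the jumps created by extending a
function by zero. -/
lemma IsCausal.continuous_convolution {F : ℝ → E} (hF : IsCausal F) {a : ℝ} (ha : 0 < a)
    (hc : ∀ᵐ x, ContinuousAt F x) :
    Continuous (powKernel a ⋆[ContinuousLinearMap.lsmul ℝ ℝ] F) := by
  refine continuous_iff_continuousAt.2 fun x => ?_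
  obtain ⟨M, hM⟩ := hF.bdd (x + 1)
  have hb : Integrable (fun t => M * (Iic (x + 1)).indicator (powKernel a) t) :=
    ((integrable_indicator_iff measurableSet_Iic).2
      (integrableOn_powKernel ha (x + 1))).const_mul M
  refine continuousAt_of_dominated (bound := fun t => M * (Iic (x + 1)).indicator (powKernel a) t)
    (Eventually.of_forall fun y => (hF.convolutionExistsAt ha y).aestronglyMeasurable) ?_ hb ?_
  · filter_upwards [Iic_mem_nhds (lt_add_one x)] with y hy
    refine ae_of_all _ fun t => ?_
    simp only [ContinuousLinearMap.lsmul_apply, norm_smul,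
      Real.norm_of_nonneg (powKernel_nonneg a t)]
    rcases le_or_gt t 0 with h0 | h0
    · rw [powKernel_of_nonpos a h0]
      by_cases h : t ∈ Iic (x + 1) <;> simp [h, powKernel_of_nonpos a h0]
    rcases le_or_gt t (x + 1) with h | h
    · rw [indicator_of_mem (mem_Iic.2 h), mul_comm]
      exact mul_le_mul_of_nonneg_right (hM _ (by linarith [mem_Iic.1 hy])) (powKernel_nonneg a t)
    · rw [hF.zero _ (by linarith [mem_Iic.1 hy]), indicator_of_notMem (by simpa using h)]; simp
  · filter_upwards [(quasiMeasurePreserving_sub_left_of_right_invariant volume x).ae hc] with t ht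
    simp only [ContinuousLinearMap.lsmul_apply]
    exact (ContinuousAt.comp (f := fun y => y - t) (g := F) (x := x) ht
      (by fun_prop)).const_smul (powKernel a t)

lemma IsCausal.convolution {F : ℝ → E} (hF : IsCausal F) {a : ℝ} (ha : 0 < a)
    (hc : ∀ᵐ x, ContinuousAt F x) :
    IsCausal (powKernel a ⋆[ContinuousLinearMap.lsmul ℝ ℝ] F) := by
  have h0 : ∀ x ≤ 0, (powKernel a ⋆[ContinuousLinearMap.lsmul ℝ ℝ] F) x = 0 := fun x hx => by
    rw [convolution_powKernel_eq hF.zero, Ioo_eq_empty (by simpa using hx)]; simp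
  have hcont := hF.continuous_convolution ha hc
  refine ⟨hcont.aestronglyMeasurable, h0, fun c => ?_⟩
  obtain ⟨M, hM⟩ := (isCompact_Icc (a := (0 : ℝ)) (b := c)).exists_bound_of_continuousOn
    hcont.continuousOn
  refine ⟨max M 0, fun x hx => ?_⟩
  rcases le_or_gt x 0 with h | h
  · simp [h0 x h]
  · exact (hM x ⟨h.le, hx⟩).trans (le_max_left _ _)

/-- This is the scaled Beta integral `B(1-a, a)`; the exponents add up so that the power of `x` is
`x ^ 0`, and `Γ(1) = 1`. -/
lemma integral_rpow_mul_rpow {a : ℝ} (ha : 0 < a) (ha1 : a < 1) {x : ℝ} (hx : 0 < x) :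
    ∫ s in Ioo 0 x, (x - s) ^ (a - 1) * s ^ (-a) = Real.Gamma a * Real.Gamma (1 - a) := by
  have h1 := Complex.betaIntegral_scaled ((1 - a : ℝ) : ℂ) (a : ℂ) hx
  have h2 := Complex.Gamma_mul_Gamma_eq_betaIntegral (s := ((1 - a : ℝ) : ℂ)) (t := (a : ℂ))
    (by simpa using ha1) (by simpa using ha)
  have e : ((1 - a : ℝ) : ℂ) + a = 1 := by push_cast; ring
  rw [e, Complex.Gamma_one, one_mul, Complex.Gamma_ofReal, Complex.Gamma_ofReal] at h2
  rw [e, sub_self, Complex.cpow_zero, one_mul, ← h2, intervalIntegral.integral_of_le hx.le,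
    integral_Ioc_eq_integral_Ioo] at h1
  apply Complex.ofReal_injective
  rw [← integral_complex_ofReal, Complex.ofReal_mul, mul_comm (Real.Gamma a : ℂ), ← h1]
  refine setIntegral_congr_fun measurableSet_Ioo fun s hs => ?_
  rw [Complex.ofReal_mul, Complex.ofReal_cpow (by linarith [hs.2]), Complex.ofReal_cpow hs.1.le,
    mul_comm]
  push_cast
  congr 2
  ring

lemma convolutionExistsAt_powKernel {a : ℝ} (ha : 0 < a) (ha1 : a < 1) (x : ℝ) :
    ConvolutionExistsAt (powKernel a) (powKernel (1 - a)) x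
      (ContinuousLinearMap.lsmul ℝ ℝ) volume := by
  rcases le_or_gt x 0 with hx | hx
  · refine (integrable_zero ℝ ℝ volume).congr (ae_of_all _ fun t => ?_)
    rcases le_or_gt t 0 with h0 | h0
    · simp [powKernel_of_nonpos a h0]
    · simp [powKernel_of_nonpos (1 - a) (show x - t ≤ 0 by linarith)]
  · refine Integrable.congr (f := (Ioo 0 x).indicator
      (fun t => t ^ (a - 1) * (x - t) ^ (1 - a - 1))) ?_ (ae_of_all _ fun t => ?_)
    · rw [integrable_indicator_iff measurableSet_Ioo]
      -- A non-integrable function has integral `0` by convention, so the nonzero Beta value already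
      -- proves integrability.
      refine Integrable.of_integral_ne_zero ?_
      have h := integral_rpow_mul_rpow (a := 1 - a) (by linarith) (by linarith) hx
      rw [show -(1 - a) = a - 1 by ring] at h
      rw [setIntegral_congr_fun measurableSet_Ioo fun t _ => mul_comm _ _, h]
      exact (mul_pos (Real.Gamma_pos_of_pos (by linarith))
        (Real.Gamma_pos_of_pos (by linarith))).ne'
    · by_cases ht : t ∈ Ioo 0 x
      · rw [indicator_of_mem ht]
        simp [powKernel_of_pos a ht.1, powKernel_of_pos (1 - a) (show 0 < x - t by linarith [ht.2])]
      · rw [indicator_of_notMem ht]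
        rcases le_or_gt t 0 with h0 | h0
        · simp [powKernel_of_nonpos a h0]
        · have : x ≤ t := by by_contra h; exact ht ⟨h0, not_le.1 h⟩
          simp [powKernel_of_nonpos (1 - a) (show x - t ≤ 0 by linarith)]

lemma powKernel_convolution_powKernel {a : ℝ} (ha : 0 < a) (ha1 : a < 1) :
    powKernel a ⋆[ContinuousLinearMap.lsmul ℝ ℝ] powKernel (1 - a) =
      (Ioi 0).indicator fun _ => Real.Gamma a * Real.Gamma (1 - a) := by
  ext x
  rw [convolution_powKernel_eq (fun x hx => powKernel_of_nonpos _ hx)]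
  rcases le_or_gt x 0 with hx | hx
  · rw [Ioo_eq_empty (by simpa using hx), indicator_of_notMem (by simpa using hx)]; simp
  · rw [indicator_of_mem (mem_Ioi.2 hx), ← integral_rpow_mul_rpow ha ha1 hx]
    refine setIntegral_congr_fun measurableSet_Ioo fun s hs => ?_
    simp [powKernel_of_pos _ hs.1]

/-- The semigroup property: fractional integration of the orders `1 - a` and `a` composes to the
ordinary integral. -/
lemma IsCausal.convolution_convolution {F : ℝ → E} [CompleteSpace E] (hF : IsCausal F) {a : ℝ}
    (ha : 0 < a) (ha1 : a < 1) (hc : ∀ᵐ x, ContinuousAt F x) (x : ℝ) :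
    (powKernel a ⋆[ContinuousLinearMap.lsmul ℝ ℝ]
      (powKernel (1 - a) ⋆[ContinuousLinearMap.lsmul ℝ ℝ] F)) x =
      (Real.Gamma a * Real.Gamma (1 - a)) • ∫ s in Ioo 0 x, F s := by
  have hnorm : ∀ b : ℝ, (fun x => ‖powKernel b x‖) = powKernel b := fun b => by
    ext x; exact Real.norm_of_nonneg (powKernel_nonneg b x)
  have hcn : ∀ᵐ x, ContinuousAt (fun x => ‖F x‖) x := hc.mono fun _ h => h.norm
  rw [← convolution_assoc (ContinuousLinearMap.lsmul ℝ ℝ) (ContinuousLinearMap.lsmul ℝ ℝ)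
    (ContinuousLinearMap.lsmul ℝ ℝ) (ContinuousLinearMap.lsmul ℝ ℝ)
    (by intro x y z; simp [mul_smul, smul_comm x y z])
    (measurable_powKernel a).aestronglyMeasurable
    (measurable_powKernel (1 - a)).aestronglyMeasurable hF.meas
    (ae_of_all _ fun y => convolutionExistsAt_powKernel ha ha1 y)
    (ae_of_all _ fun y => by
      rw [hnorm]; exact hF.norm.convolutionExistsAt (by linarith) y)
    (by
      rw [hnorm, hnorm]
      exact (hF.norm.convolution (a := 1 - a) (by linarith) hcn).convolutionExistsAt ha x)]
  rw [powKernel_convolution_powKernel ha ha1, convolution_lsmul_swap, ← integral_smul,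
    ← integral_indicator measurableSet_Ioo]
  refine integral_congr_ae (ae_of_all _ fun t => ?_)
  by_cases ht : t ∈ Ioo 0 x
  · simp only [indicator_of_mem ht]
    rw [indicator_of_mem (by simpa using ht.2)]
  · simp only [indicator_of_notMem ht]
    rcases le_or_gt t 0 with h0 | h0
    · simp [hF.zero t h0]
    · have : x ≤ t := by by_contra h; exact ht ⟨h0, not_le.1 h⟩
      rw [indicator_of_notMem (by simpa using this), zero_smul]

/-- Reflecting `s ↦ x - s` pulls out `exp (ν x)`; the remaining integral is part of the Gamma
integral with rate `ν`. The factor `ν ^ (-a)` is what later makes the Volterra operator a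
contraction. -/
lemma setIntegral_rpow_mul_exp_le {a ν : ℝ} (ha : 0 < a) (hν : 0 < ν) (x : ℝ) :
    ∫ s in Ioo 0 x, (x - s) ^ (a - 1) * Real.exp (ν * s) ≤
      (1 / ν) ^ a * Real.Gamma a * Real.exp (ν * x) := by
  have hpos : 0 ≤ (1 / ν) ^ a * Real.Gamma a * Real.exp (ν * x) := by positivity
  rw [← Real.integral_rpow_mul_exp_neg_mul_Ioi ha hν, ← integral_mul_const]
  have hint : IntegrableOn (fun t : ℝ => t ^ (a - 1) * Real.exp (-(ν * t))) (Ioi 0) := by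
    refine Integrable.of_integral_ne_zero ?_
    rw [Real.integral_rpow_mul_exp_neg_mul_Ioi ha hν]
    positivity
  have e : ∫ s in Ioo 0 x, (x - s) ^ (a - 1) * Real.exp (ν * s) =
      ∫ t in Ioo 0 x, t ^ (a - 1) * Real.exp (-(ν * t)) * Real.exp (ν * x) := by
    rw [← integral_indicator measurableSet_Ioo, ← integral_indicator measurableSet_Ioo,
      ← integral_sub_left_eq_self _ volume x]
    refine integral_congr_ae (ae_of_all _ fun t => ?_)
    by_cases ht : t ∈ Ioo 0 x
    · have ht' : x - t ∈ Ioo 0 x := ⟨by linarith [ht.2], by linarith [ht.1]⟩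
      simp only [indicator_of_mem ht, indicator_of_mem ht']
      rw [mul_assoc, ← Real.exp_add]
      ring_nf
    · have ht' : x - t ∉ Ioo 0 x := fun h => ht ⟨by linarith [h.2], by linarith [h.1]⟩
      simp only [indicator_of_notMem ht, indicator_of_notMem ht']
  rw [e]
  refine setIntegral_mono_set (hint.mul_const _) ?_
    Ioo_subset_Ioi_self.eventuallyLE
  filter_upwards [ae_restrict_mem measurableSet_Ioi] with t ht
  have := Real.rpow_nonneg (le_of_lt (mem_Ioi.1 ht)) (a - 1)
  simp only [Pi.zero_apply]
  positivity

end PowKernel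

/-! ### Fractional integrals on a time scale -/

section TimeScale

variable {T : ℝ} {φ : ℝ → ℝ}

lemma IsTimeScale.hasDerivWithinAt (hφ : IsTimeScale T φ) {t : ℝ} (ht : t ∈ Icc 0 T) :
    HasDerivWithinAt φ (dphi T φ t) (Icc 0 T) t :=
  ((hφ.contDiffOn.differentiableOn one_ne_zero) t ht).hasDerivWithinAt

lemma IsTimeScale.continuousOn_dphi (hφ : IsTimeScale T φ) (hT : 0 < T) :
    ContinuousOn (dphi T φ) (Icc 0 T) :=
  hφ.contDiffOn.continuousOn_derivWithin (uniqueDiffOn_Icc hT) le_rfl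

lemma IsTimeScale.strictMonoOn (hφ : IsTimeScale T φ) : StrictMonoOn φ (Icc 0 T) := by
  refine strictMonoOn_of_deriv_pos (convex_Icc 0 T) hφ.contDiffOn.continuousOn fun t ht => ?_
  rw [interior_Icc] at ht
  have h := (hφ.hasDerivWithinAt (Ioo_subset_Icc_self ht)).hasDerivAt (Icc_mem_nhds ht.1 ht.2)
  rw [h.deriv]
  exact hφ.dphi_pos t (Ioo_subset_Icc_self ht)

lemma IsTimeScale.image_Ioo (hφ : IsTimeScale T φ) {t : ℝ} (ht : t ∈ Icc 0 T) :
    (fun s => φ s - φ 0) '' Ioo 0 t = Ioo 0 (φ t - φ 0) := by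
  have hsub : Icc 0 t ⊆ Icc 0 T := Icc_subset_Icc_right ht.2
  have h0 : (0 : ℝ) ∈ Icc 0 T := ⟨le_rfl, ht.1.trans ht.2⟩
  apply Subset.antisymm
  · rintro _ ⟨s, hs, rfl⟩
    have hs' : s ∈ Icc 0 T := hsub (Ioo_subset_Icc_self hs)
    exact ⟨sub_pos.2 (hφ.strictMonoOn h0 hs' hs.1),
      sub_lt_sub_right (hφ.strictMonoOn hs' ht hs.2) _⟩
  · have h := intermediate_value_Ioo ht.1
      ((hφ.contDiffOn.continuousOn.mono hsub).sub (continuousOn_const (c := φ 0)))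
    simpa using h

lemma IsTimeScale.injOn (hφ : IsTimeScale T φ) {t : ℝ} (ht : t ∈ Icc 0 T) :
    InjOn (fun s => φ s - φ 0) (Ioo 0 t) := fun _ hx _ hy h =>
  hφ.strictMonoOn.injOn (Icc_subset_Icc_right ht.2 (Ioo_subset_Icc_self hx))
    (Icc_subset_Icc_right ht.2 (Ioo_subset_Icc_self hy)) (sub_left_injective h)

lemma IsTimeScale.hasDerivWithinAt_Ioo (hφ : IsTimeScale T φ) {t : ℝ} (ht : t ∈ Icc 0 T) :
    ∀ s ∈ Ioo 0 t, HasDerivWithinAt (fun s => φ s - φ 0) (dphi T φ s) (Ioo 0 t) s := fun _ hs =>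
  have hsub : Ioo 0 t ⊆ Icc 0 T := Ioo_subset_Icc_self.trans (Icc_subset_Icc_right ht.2)
  ((hφ.hasDerivWithinAt (hsub hs)).mono hsub).sub_const _

variable {E : Type*} [NormedAddCommGroup E] [NormedSpace ℝ E]

lemma IsTimeScale.setIntegral_eq (hφ : IsTimeScale T φ) {t : ℝ} (ht : t ∈ Icc 0 T) (G : ℝ → E) :
    ∫ x in Ioo 0 (φ t - φ 0), G x = ∫ s in Ioo 0 t, dphi T φ s • G (φ s - φ 0) := by
  rw [← hφ.image_Ioo ht, integral_image_eq_integral_abs_deriv_smul measurableSet_Ioo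
    (hφ.hasDerivWithinAt_Ioo ht) (hφ.injOn ht)]
  refine setIntegral_congr_fun measurableSet_Ioo fun s hs => ?_
  rw [abs_of_pos (hφ.dphi_pos s (Icc_subset_Icc_right ht.2 (Ioo_subset_Icc_self hs)))]

lemma IsTimeScale.integrableOn_iff (hφ : IsTimeScale T φ) {t : ℝ} (ht : t ∈ Icc 0 T)
    (G : ℝ → E) : IntegrableOn G (Ioo 0 (φ t - φ 0)) ↔
      IntegrableOn (fun s => dphi T φ s • G (φ s - φ 0)) (Ioo 0 t) := by
  rw [← hφ.image_Ioo ht, integrableOn_image_iff_integrableOn_abs_deriv_smul measurableSet_Ioo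
    (hφ.hasDerivWithinAt_Ioo ht) (hφ.injOn ht)]
  refine integrableOn_congr_fun (fun s hs => ?_) measurableSet_Ioo
  rw [abs_of_pos (hφ.dphi_pos s (Icc_subset_Icc_right ht.2 (Ioo_subset_Icc_self hs)))]

lemma rlIntegral_eq {a t : ℝ} (ha : a ≠ 0) (ht : 0 ≤ t) (f : ℝ → E) :
    rlIntegral T φ a f t = (Real.Gamma a)⁻¹ •
      ∫ s in Ioo 0 t, (dphi T φ s * (φ t - φ s) ^ (a - 1)) • f s := by
  rw [rlIntegral, if_neg ha, intervalIntegral.integral_of_le ht, integral_Ioc_eq_integral_Ioo]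

lemma rlIntegral_congr {a t : ℝ} (ha : a ≠ 0) (ht : 0 ≤ t) {f g : ℝ → E}
    (h : EqOn f g (Ioo 0 t)) : rlIntegral T φ a f t = rlIntegral T φ a g t := by
  rw [rlIntegral_eq ha ht, rlIntegral_eq ha ht]
  congr 1
  exact setIntegral_congr_fun measurableSet_Ioo fun s hs => by simp only [h hs]

lemma rlIntegral_one {t : ℝ} (ht : 0 ≤ t) (f : ℝ → E) :
    rlIntegral T φ 1 f t = ∫ s in Ioo 0 t, dphi T φ s • f s := by
  rw [rlIntegral_eq one_ne_zero ht]
  simp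

lemma rlIntegral_zero_right {a : ℝ} (ha : a ≠ 0) (f : ℝ → E) : rlIntegral T φ a f 0 = 0 := by
  simp [rlIntegral_eq ha le_rfl]

/-- The inverse of `s ↦ φ s - φ 0` on `[0,T]`. -/
noncomputable def timeInv (T : ℝ) (φ : ℝ → ℝ) : ℝ → ℝ :=
  Function.invFunOn (fun s => φ s - φ 0) (Icc 0 T)

lemma IsTimeScale.timeInv_apply (hφ : IsTimeScale T φ) {s : ℝ} (hs : s ∈ Icc 0 T) :
    timeInv T φ (φ s - φ 0) = s := by
  have hinj : InjOn (fun s => φ s - φ 0) (Icc 0 T) := fun _ hx _ hy h =>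
    hφ.strictMonoOn.injOn hx hy (sub_left_injective h)
  exact hinj.leftInvOn_invFunOn hs

lemma IsTimeScale.continuousAt_timeInv (hφ : IsTimeScale T φ) (hT : 0 < T) {x : ℝ}
    (hx : x ∈ Ioo 0 (φ T - φ 0)) : ContinuousAt (timeInv T φ) x := by
  have hTm : T ∈ Icc 0 T := ⟨hT.le, le_rfl⟩
  have himg : timeInv T φ '' Ioo 0 (φ T - φ 0) = Ioo 0 T := by
    rw [← hφ.image_Ioo hTm, image_image]
    have h : EqOn (fun s => timeInv T φ (φ s - φ 0)) id (Ioo 0 T) := fun s hs =>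
      hφ.timeInv_apply (Ioo_subset_Icc_self hs)
    rw [h.image_eq, image_id]
  have hmono : StrictMonoOn (timeInv T φ) (Ioo 0 (φ T - φ 0)) := by
    rw [← hφ.image_Ioo hTm]
    rintro _ ⟨s, hs, rfl⟩ _ ⟨r, hr, rfl⟩ h
    simp only
    rw [hφ.timeInv_apply (Ioo_subset_Icc_self hs), hφ.timeInv_apply (Ioo_subset_Icc_self hr)]
    exact (hφ.strictMonoOn.lt_iff_lt (Ioo_subset_Icc_self hs) (Ioo_subset_Icc_self hr)).1
      (by linarith)
  refine hmono.continuousAt_of_image_mem_nhds (Ioo_mem_nhds hx.1 hx.2) ?_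
  rw [himg]
  have : timeInv T φ x ∈ Ioo 0 T := himg ▸ mem_image_of_mem _ hx
  exact Ioo_mem_nhds this.1 this.2

/-- The function `f` in the variable `x = φ t - φ 0`, extended by zero. -/
noncomputable def timeLift (T : ℝ) (φ : ℝ → ℝ) (f : ℝ → E) : ℝ → E :=
  (Ioo 0 (φ T - φ 0)).indicator (fun x => f (timeInv T φ x))

omit [NormedSpace ℝ E] in
lemma timeLift_of_nonpos (f : ℝ → E) {x : ℝ} (hx : x ≤ 0) : timeLift T φ f x = 0 :=
  indicator_of_notMem (fun h => absurd h.1 hx.not_gt) _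

omit [NormedSpace ℝ E] in
lemma IsTimeScale.timeLift_apply (hφ : IsTimeScale T φ) (f : ℝ → E) {s : ℝ} (hs : s ∈ Ioo 0 T) :
    timeLift T φ f (φ s - φ 0) = f s := by
  have hTm : T ∈ Icc 0 T := ⟨(hs.1.trans hs.2).le, le_rfl⟩
  have : φ s - φ 0 ∈ Ioo 0 (φ T - φ 0) := by
    rw [← hφ.image_Ioo hTm]; exact mem_image_of_mem (fun s => φ s - φ 0) hs
  rw [timeLift, indicator_of_mem this, hφ.timeInv_apply (Ioo_subset_Icc_self hs)]

lemma IsTimeScale.timeInv_mem (hφ : IsTimeScale T φ) (hT : 0 < T) {x : ℝ}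
    (hx : x ∈ Ioo 0 (φ T - φ 0)) : timeInv T φ x ∈ Ioo 0 T ∧ φ (timeInv T φ x) - φ 0 = x := by
  rw [← hφ.image_Ioo ⟨hT.le, le_rfl⟩] at hx
  obtain ⟨s, hs, rfl⟩ := hx
  simp only
  rw [hφ.timeInv_apply (Ioo_subset_Icc_self hs)]
  exact ⟨hs, rfl⟩

-- Only the two end points, where the extension by zero may jump, are exceptional.
omit [NormedSpace ℝ E] in
lemma IsTimeScale.continuousAt_timeLift (hφ : IsTimeScale T φ) (hT : 0 < T) {f : ℝ → E}
    (hf : ContinuousOn f (Icc 0 T)) : ∀ᵐ x, ContinuousAt (timeLift T φ f) x := by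
  have hfin : ({0, φ T - φ 0} : Set ℝ).Finite := toFinite _
  filter_upwards [hfin.countable.ae_notMem volume] with x hx
  simp only [mem_insert_iff, mem_singleton_iff, not_or] at hx
  by_cases h : x ∈ Ioo 0 (φ T - φ 0)
  · have hev : timeLift T φ f =ᶠ[𝓝 x] fun x => f (timeInv T φ x) := by
      filter_upwards [Ioo_mem_nhds h.1 h.2] with y hy
      exact indicator_of_mem hy _
    refine ContinuousAt.congr ?_ hev.symm
    have hm := (hφ.timeInv_mem hT h).1
    exact ContinuousAt.comp (g := f) (hf.continuousAt (Icc_mem_nhds hm.1 hm.2))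
      (hφ.continuousAt_timeInv hT h)
  · have hev : timeLift T φ f =ᶠ[𝓝 x] fun _ => (0 : E) := by
      have hx' : x ∉ Icc 0 (φ T - φ 0) := fun h' =>
        h ⟨lt_of_le_of_ne h'.1 (Ne.symm hx.1), lt_of_le_of_ne h'.2 hx.2⟩
      filter_upwards [isClosed_Icc.isOpen_compl.mem_nhds hx'] with y hy
      exact indicator_of_notMem (fun h' => hy (Ioo_subset_Icc_self h')) _
    exact continuousAt_const.congr hev.symm

omit [NormedSpace ℝ E] in
lemma IsTimeScale.isCausal_timeLift (hφ : IsTimeScale T φ) (hT : 0 < T) {f : ℝ → E}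
    (hf : ContinuousOn f (Icc 0 T)) : IsCausal (timeLift T φ f) where
  meas := by
    refine (aestronglyMeasurable_indicator_iff measurableSet_Ioo).2 ?_
    refine ContinuousOn.aestronglyMeasurable (fun x hx => ?_) measurableSet_Ioo
    have hm := (hφ.timeInv_mem hT hx).1
    exact (ContinuousAt.comp (g := f) (hf.continuousAt (Icc_mem_nhds hm.1 hm.2))
      (hφ.continuousAt_timeInv hT hx)).continuousWithinAt
  zero x hx := timeLift_of_nonpos f hx
  bdd c := by
    obtain ⟨M, hM⟩ := isCompact_Icc.exists_bound_of_continuousOn hf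
    refine ⟨max M 0, fun x _ => ?_⟩
    by_cases h : x ∈ Ioo 0 (φ T - φ 0)
    · rw [timeLift, indicator_of_mem h]
      exact (hM _ (Ioo_subset_Icc_self (hφ.timeInv_mem hT h).1)).trans (le_max_left _ _)
    · rw [timeLift, indicator_of_notMem h]; simp

/-- The fractional integral as a convolution in the variable `x = φ t - φ 0`. -/
lemma IsTimeScale.rlIntegral_eq_convolution (hφ : IsTimeScale T φ) {a t : ℝ} (ha : a ≠ 0)
    (ht : t ∈ Icc 0 T) (f : ℝ → E) :
    rlIntegral T φ a f t = (Real.Gamma a)⁻¹ •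
      (powKernel a ⋆[ContinuousLinearMap.lsmul ℝ ℝ] timeLift T φ f) (φ t - φ 0) := by
  rw [rlIntegral_eq ha ht.1, convolution_powKernel_eq (fun x hx => timeLift_of_nonpos f hx),
    hφ.setIntegral_eq ht]
  congr 1
  refine setIntegral_congr_fun measurableSet_Ioo fun s hs => ?_
  rw [hφ.timeLift_apply f ⟨hs.1, hs.2.trans_le ht.2⟩, sub_sub_sub_cancel_right, mul_smul]

lemma IsTimeScale.continuousOn_rlIntegral (hφ : IsTimeScale T φ) (hT : 0 < T) {a : ℝ}
    (ha : 0 < a) {f : ℝ → E} (hf : ContinuousOn f (Icc 0 T)) :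
    ContinuousOn (rlIntegral T φ a f) (Icc 0 T) := by
  have h : ContinuousOn (fun t => (Real.Gamma a)⁻¹ •
      (powKernel a ⋆[ContinuousLinearMap.lsmul ℝ ℝ] timeLift T φ f) (φ t - φ 0)) (Icc 0 T) :=
    ((((hφ.isCausal_timeLift hT hf).continuous_convolution ha
      (hφ.continuousAt_timeLift hT hf)).comp_continuousOn
      (hφ.contDiffOn.continuousOn.sub continuousOn_const))).const_smul _
  exact h.congr fun t ht => hφ.rlIntegral_eq_convolution ha.ne' ht f

lemma IsTimeScale.rlIntegral_rlIntegral [CompleteSpace E] (hφ : IsTimeScale T φ) (hT : 0 < T)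
    {a : ℝ} (ha : 0 < a) (ha1 : a < 1) {f : ℝ → E} (hf : ContinuousOn f (Icc 0 T)) {t : ℝ}
    (ht : t ∈ Icc 0 T) :
    rlIntegral T φ a (rlIntegral T φ (1 - a) f) t = ∫ s in Ioo 0 t, dphi T φ s • f s := by
  have hc := hφ.isCausal_timeLift hT hf
  have hca := hφ.continuousAt_timeLift hT hf
  have hb : 0 < 1 - a := by linarith
  rw [hφ.rlIntegral_eq_convolution ha.ne' ht,
    convolution_powKernel_eq (fun x hx => timeLift_of_nonpos _ hx)]
  -- The lift of `I^{1-a} f` is cut off at `φ T - φ 0` whereas the convolution is not, but the two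
  -- agree on the range that the outer integral sees.
  have e1 : ∫ s in Ioo 0 (φ t - φ 0), (φ t - φ 0 - s) ^ (a - 1) •
        timeLift T φ (rlIntegral T φ (1 - a) f) s =
      ∫ s in Ioo 0 (φ t - φ 0), (Real.Gamma (1 - a))⁻¹ • ((φ t - φ 0 - s) ^ (a - 1) •
        (powKernel (1 - a) ⋆[ContinuousLinearMap.lsmul ℝ ℝ] timeLift T φ f) s) := by
    refine setIntegral_congr_fun measurableSet_Ioo fun x hx => ?_
    rw [← hφ.image_Ioo ht] at hx
    obtain ⟨s, hs, rfl⟩ := hx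
    simp only
    rw [hφ.timeLift_apply _ ⟨hs.1, hs.2.trans_le ht.2⟩,
      hφ.rlIntegral_eq_convolution hb.ne' ⟨hs.1.le, hs.2.le.trans ht.2⟩, smul_comm]
  rw [e1, integral_smul, ← convolution_powKernel_eq (hc.convolution hb hca).zero,
    hc.convolution_convolution ha ha1 hca, smul_smul, smul_smul, hφ.setIntegral_eq ht]
  have hg : (Real.Gamma a)⁻¹ * (Real.Gamma (1 - a))⁻¹ *
      (Real.Gamma a * Real.Gamma (1 - a)) = 1 := by
    have := (Real.Gamma_pos_of_pos ha).ne'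
    have := (Real.Gamma_pos_of_pos hb).ne'
    field_simp
  rw [hg, one_smul]
  refine setIntegral_congr_fun measurableSet_Ioo fun s hs => ?_
  rw [hφ.timeLift_apply f ⟨hs.1, hs.2.trans_le ht.2⟩]

end TimeScale

/-! ### Fractional differential and Volterra equations -/

section FractionalEquations

variable {T : ℝ} {φ : ℝ → ℝ} {E : Type*} [NormedAddCommGroup E] [NormedSpace ℝ E]

lemma IsTimeScale.integrableOn_kernel (hφ : IsTimeScale T φ) {a t : ℝ} (ha : 0 < a)
    (ht : t ∈ Icc 0 T) :
    IntegrableOn (fun s => dphi T φ s * (φ t - φ s) ^ (a - 1)) (Ioo 0 t) := by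
  have h := (hφ.integrableOn_iff ht (fun x => (φ t - φ 0 - x) ^ (a - 1))).1 ?_
  · simpa only [sub_sub_sub_cancel_right, smul_eq_mul] using h
  · have h0 : (0 : ℝ) ∈ Icc 0 T := ⟨le_rfl, ht.1.trans ht.2⟩
    have hle : 0 ≤ φ t - φ 0 := sub_nonneg.2 (hφ.strictMonoOn.monotoneOn h0 ht ht.1)
    have h1 := (intervalIntegral.intervalIntegrable_rpow' (a := 0) (b := φ t - φ 0)
      (r := a - 1) (by linarith)).comp_sub_left (φ t - φ 0)
    rw [sub_self, sub_zero] at h1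
    exact ((intervalIntegrable_iff_integrableOn_Ioc_of_le hle).1 h1.symm).mono_set
      Ioo_subset_Ioc_self

lemma IsTimeScale.kernel_nonneg (hφ : IsTimeScale T φ) (a : ℝ) {t s : ℝ}
    (ht : t ∈ Icc 0 T) (hs : s ∈ Ioo 0 t) : 0 ≤ dphi T φ s * (φ t - φ s) ^ (a - 1) := by
  have hs' : s ∈ Icc 0 T := ⟨hs.1.le, hs.2.le.trans ht.2⟩
  exact mul_nonneg (hφ.dphi_pos s hs').le
    (Real.rpow_nonneg (sub_nonneg.2 (hφ.strictMonoOn.monotoneOn hs' ht hs.2.le)) _)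

lemma IsTimeScale.integrableOn_kernel_smul (hφ : IsTimeScale T φ) {a t : ℝ} (ha : 0 < a)
    (ht : t ∈ Icc 0 T) {f : ℝ → E} (hf : AEStronglyMeasurable f (volume.restrict (Icc 0 T)))
    {M : ℝ} (hM : ∀ s ∈ Icc 0 T, ‖f s‖ ≤ M) :
    IntegrableOn (fun s => (dphi T φ s * (φ t - φ s) ^ (a - 1)) • f s) (Ioo 0 t) := by
  have hsub : Ioo 0 t ⊆ Icc 0 T := Ioo_subset_Icc_self.trans (Icc_subset_Icc_right ht.2)
  have hk := hφ.integrableOn_kernel ha ht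
  refine (hk.const_mul M).mono' (hk.aestronglyMeasurable.smul (hf.mono_set hsub)) ?_
  filter_upwards [ae_restrict_mem measurableSet_Ioo] with s hs
  rw [norm_smul, Real.norm_of_nonneg (hφ.kernel_nonneg a ht hs), mul_comm]
  exact mul_le_mul_of_nonneg_right (hM s (hsub hs)) (hφ.kernel_nonneg a ht hs)

lemma IsTimeScale.rlIntegral_add (hφ : IsTimeScale T φ) {a t : ℝ} (ha : 0 < a)
    (ht : t ∈ Icc 0 T) {f g : ℝ → E} (hf : AEStronglyMeasurable f (volume.restrict (Icc 0 T)))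
    (hg : AEStronglyMeasurable g (volume.restrict (Icc 0 T)))
    {M N : ℝ} (hM : ∀ s ∈ Icc 0 T, ‖f s‖ ≤ M) (hN : ∀ s ∈ Icc 0 T, ‖g s‖ ≤ N) :
    rlIntegral T φ a (fun s => f s + g s) t = rlIntegral T φ a f t + rlIntegral T φ a g t := by
  simp only [rlIntegral_eq ha.ne' ht.1, smul_add]
  rw [integral_add (hφ.integrableOn_kernel_smul ha ht hf hM)
    (hφ.integrableOn_kernel_smul ha ht hg hN), smul_add]

lemma rlIntegral_smul {𝕜 : Type*} [NormedDivisionRing 𝕜] [Module 𝕜 E] [NormSMulClass 𝕜 E]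
    [SMulCommClass ℝ 𝕜 E] {a t : ℝ} (ha : a ≠ 0) (ht : 0 ≤ t) (c : 𝕜) (f : ℝ → E) :
    rlIntegral T φ a (fun s => c • f s) t = c • rlIntegral T φ a f t := by
  simp only [rlIntegral_eq ha ht, smul_comm _ c]
  rw [integral_smul, smul_comm]

lemma IsTimeScale.tendsto_rlIntegral (hφ : IsTimeScale T φ) {a t : ℝ} (ha : 0 < a)
    (ht : t ∈ Icc 0 T) {f : ℕ → ℝ → E} {g : ℝ → E}
    (hf : ∀ k, AEStronglyMeasurable (f k) (volume.restrict (Icc 0 T)))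
    {M : ℝ} (hM : ∀ k, ∀ s ∈ Icc 0 T, ‖f k s‖ ≤ M)
    (hlim : ∀ s ∈ Icc 0 T, Tendsto (fun k => f k s) atTop (𝓝 (g s))) :
    Tendsto (fun k => rlIntegral T φ a (f k) t) atTop (𝓝 (rlIntegral T φ a g t)) := by
  simp only [rlIntegral_eq ha.ne' ht.1]
  have hsub : Ioo 0 t ⊆ Icc 0 T := Ioo_subset_Icc_self.trans (Icc_subset_Icc_right ht.2)
  have hk := hφ.integrableOn_kernel ha ht
  refine Tendsto.const_smul (tendsto_integral_of_dominated_convergence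
    (fun s => M * (dphi T φ s * (φ t - φ s) ^ (a - 1)))
    (fun k => hk.aestronglyMeasurable.smul ((hf k).mono_set hsub)) (hk.const_mul M) ?_ ?_) _
  · intro k
    filter_upwards [ae_restrict_mem measurableSet_Ioo] with s hs
    change ‖(dphi T φ s * (φ t - φ s) ^ (a - 1)) • f k s‖ ≤ _
    rw [norm_smul, Real.norm_of_nonneg (hφ.kernel_nonneg a ht hs), mul_comm]
    exact mul_le_mul_of_nonneg_right (hM k s (hsub hs)) (hφ.kernel_nonneg a ht hs)
  · filter_upwards [ae_restrict_mem measurableSet_Ioo] with s hs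
    exact (hlim s (hsub hs)).const_smul _

lemma IsTimeScale.rlIntegral_exp_le (hφ : IsTimeScale T φ) {a ν t : ℝ} (ha : 0 < a)
    (hν : 0 < ν) (ht : t ∈ Icc 0 T) :
    rlIntegral T φ a (fun s => Real.exp (ν * (φ s - φ 0))) t ≤
      (1 / ν) ^ a * Real.exp (ν * (φ t - φ 0)) := by
  have hG := Real.Gamma_pos_of_pos ha
  have e : ∫ s in Ioo 0 t, (dphi T φ s * (φ t - φ s) ^ (a - 1)) • Real.exp (ν * (φ s - φ 0)) =
      ∫ x in Ioo 0 (φ t - φ 0), (φ t - φ 0 - x) ^ (a - 1) * Real.exp (ν * x) := by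
    rw [hφ.setIntegral_eq ht]
    refine setIntegral_congr_fun measurableSet_Ioo fun s _ => ?_
    simp only [sub_sub_sub_cancel_right, smul_eq_mul, mul_assoc]
  rw [rlIntegral_eq ha.ne' ht.1, e, smul_eq_mul, inv_mul_le_iff₀ hG]
  exact (setIntegral_rpow_mul_exp_le ha hν _).trans_eq (by ring)

/-- In the sup norm with weight `exp (-ν (φ - φ 0))`, the operator `I^a` has norm at most `ν ^
(-a)`, which is arbitrarily small for large `ν`. -/
lemma IsTimeScale.norm_rlIntegral_le (hφ : IsTimeScale T φ) {a ν t M : ℝ}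
    (ha : 0 < a) (hν : 0 < ν) (hM : 0 ≤ M) (ht : t ∈ Icc 0 T) {f : ℝ → E}
    (hf : ∀ s ∈ Icc 0 T, ‖f s‖ ≤ M * Real.exp (ν * (φ s - φ 0))) :
    ‖rlIntegral T φ a f t‖ ≤ M * ((1 / ν) ^ a * Real.exp (ν * (φ t - φ 0))) := by
  have hG := Real.Gamma_pos_of_pos ha
  have hsub : Ioo 0 t ⊆ Icc 0 T := Ioo_subset_Icc_self.trans (Icc_subset_Icc_right ht.2)
  have hcont : ContinuousOn (fun s => Real.exp (ν * (φ s - φ 0))) (Icc 0 T) :=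
    Real.continuous_exp.comp_continuousOn (continuousOn_const.mul
      (hφ.contDiffOn.continuousOn.sub continuousOn_const))
  obtain ⟨B, hB⟩ := isCompact_Icc.exists_bound_of_continuousOn hcont
  have hint := hφ.integrableOn_kernel_smul ha ht
    (hcont.aestronglyMeasurable measurableSet_Icc) hB
  refine le_trans ?_ (mul_le_mul_of_nonneg_left (hφ.rlIntegral_exp_le ha hν ht) hM)
  rw [rlIntegral_eq ha.ne' ht.1, rlIntegral_eq ha.ne' ht.1, norm_smul,
    Real.norm_of_nonneg (inv_nonneg.2 hG.le), smul_eq_mul, mul_left_comm]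
  refine mul_le_mul_of_nonneg_left ?_ (inv_nonneg.2 hG.le)
  rw [← integral_const_mul]
  refine norm_integral_le_of_norm_le (hint.const_mul M) ?_
  filter_upwards [ae_restrict_mem measurableSet_Ioo] with s hs
  rw [norm_smul, Real.norm_of_nonneg (hφ.kernel_nonneg a ht hs), smul_eq_mul, mul_left_comm]
  exact mul_le_mul_of_nonneg_left (hf s (hsub hs)) (hφ.kernel_nonneg a ht hs)

/-- Bounded solutions of a homogeneous linear fractional Volterra equation vanish. -/
lemma IsTimeScale.eq_zero_of_volterra (hφ : IsTimeScale T φ) (hT : 0 < T) {a : ℝ} (ha : 0 < a)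
    {y : ℝ → E} {c : ℝ → ℝ} {M N : ℝ} (hy : ∀ s ∈ Icc 0 T, ‖y s‖ ≤ M)
    (hc : ∀ s ∈ Icc 0 T, |c s| ≤ N)
    (h : ∀ t ∈ Icc 0 T, y t = rlIntegral T φ a (fun s => c s • y s) t) :
    ∀ t ∈ Icc 0 T, y t = 0 := by
  have h0 : (0 : ℝ) ∈ Icc 0 T := ⟨le_rfl, hT.le⟩
  have hM : 0 ≤ M := (norm_nonneg _).trans (hy 0 h0)
  have hN : 0 ≤ N := (abs_nonneg _).trans (hc 0 h0)
  -- Choose the weight so large that the Volterra operator has norm at most `1/2`; iterating the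
  -- equation then halves the bound each time.
  obtain ⟨ν, hν, hν'⟩ : ∃ ν : ℝ, 0 < ν ∧ N * (1 / ν) ^ a ≤ 1 / 2 := by
    have : Tendsto (fun ν : ℝ => N * (1 / ν) ^ a) atTop (𝓝 (N * 0)) := by
      refine Tendsto.const_mul _ ?_
      refine (tendsto_rpow_neg_atTop ha).congr' ?_
      filter_upwards [eventually_gt_atTop 0] with ν hν
      rw [Real.rpow_neg hν.le, one_div, Real.inv_rpow hν.le]
    rw [mul_zero] at this
    obtain ⟨ν, h1, h2⟩ := ((this.eventually (ge_mem_nhds (show (0 : ℝ) < 1 / 2 by norm_num))).and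
      (eventually_gt_atTop 0)).exists
    exact ⟨ν, h2, h1⟩
  have key : ∀ k : ℕ, ∀ t ∈ Icc 0 T, ‖y t‖ ≤ M * (1 / 2) ^ k * Real.exp (ν * (φ t - φ 0)) := by
    intro k
    induction k with
    | zero =>
      intro t ht
      have : 1 ≤ Real.exp (ν * (φ t - φ 0)) := Real.one_le_exp
        (mul_nonneg hν.le (sub_nonneg.2 (hφ.strictMonoOn.monotoneOn h0 ht ht.1)))
      rw [pow_zero, mul_one]
      exact (hy t ht).trans (le_mul_of_one_le_right hM this)
    | succ k ih =>
      intro t ht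
      rw [h t ht]
      refine (hφ.norm_rlIntegral_le ha hν (M := N * (M * (1 / 2) ^ k)) (by positivity) ht
        fun s hs => ?_).trans ?_
      · rw [norm_smul, mul_assoc]
        exact mul_le_mul (hc s hs) (ih s hs) (norm_nonneg _) hN
      · have e := Real.exp_pos (ν * (φ t - φ 0))
        calc N * (M * (1 / 2) ^ k) * ((1 / ν) ^ a * Real.exp (ν * (φ t - φ 0)))
            = (N * (1 / ν) ^ a) * (M * (1 / 2) ^ k * Real.exp (ν * (φ t - φ 0))) := by ring
          _ ≤ 1 / 2 * (M * (1 / 2) ^ k * Real.exp (ν * (φ t - φ 0))) :=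
              mul_le_mul_of_nonneg_right hν' (by positivity)
          _ = M * (1 / 2) ^ (k + 1) * Real.exp (ν * (φ t - φ 0)) := by ring
  intro t ht
  have hlim : Tendsto (fun k : ℕ => M * (1 / 2) ^ k * Real.exp (ν * (φ t - φ 0))) atTop
      (𝓝 (M * 0 * Real.exp (ν * (φ t - φ 0)))) :=
    ((tendsto_pow_atTop_nhds_zero_of_lt_one (by norm_num) (by norm_num)).const_mul M).mul_const _
  rw [mul_zero, zero_mul] at hlim
  exact norm_le_zero_iff.1 (ge_of_tendsto' hlim fun k => key k t ht)

variable [CompleteSpace E]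

/-- The derivative of `t ↦ ∫₀ᵗ φ' d`. -/
lemma IsTimeScale.hasDerivWithinAt_integral (hφ : IsTimeScale T φ) (hT : 0 < T) {d : ℝ → E}
    (hd : ContinuousOn d (Icc 0 T)) {t : ℝ} (ht : t ∈ Icc 0 T) :
    HasDerivWithinAt (fun t => ∫ s in Ioo 0 t, dphi T φ s • d s) (dphi T φ t • d t)
      (Icc 0 T) t := by
  have hc : ContinuousOn (fun s => dphi T φ s • d s) (Icc 0 T) := (hφ.continuousOn_dphi hT).smul hd
  -- Extending the integrand by constants outside `[0,T]` makes it continuous on the line, so that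
  -- the end points need no separate treatment.
  have hcont : Continuous (IccExtend hT.le ((Icc 0 T).domRestrict fun s => dphi T φ s • d s)) :=
    hc.domRestrict.Icc_extend'
  have h1 := (hcont.integral_hasStrictDerivAt 0 t).hasDerivAt.hasDerivWithinAt (s := Icc 0 T)
  rw [IccExtend_of_mem _ _ ht] at h1
  refine h1.congr_of_mem (fun u hu => ?_) ht
  rw [intervalIntegral.integral_of_le hu.1, integral_Ioc_eq_integral_Ioo]
  refine setIntegral_congr_fun measurableSet_Ioo fun s hs => ?_
  rw [IccExtend_of_mem _ _ ⟨hs.1.le, hs.2.le.trans hu.2⟩]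
  rfl

/-- Injectivity of `I^1`, by differentiation and `φ' > 0`. With the semigroup law it also yields
injectivity of `I^a` for `0 < a < 1`. -/
lemma IsTimeScale.eqOn_zero_of_integral (hφ : IsTimeScale T φ) (hT : 0 < T) {d : ℝ → E}
    (hd : ContinuousOn d (Icc 0 T))
    (h : ∀ t ∈ Icc 0 T, ∫ s in Ioo 0 t, dphi T φ s • d s = 0) : ∀ t ∈ Icc 0 T, d t = 0 := by
  intro t ht
  have h1 := hφ.hasDerivWithinAt_integral hT hd ht
  have h2 : HasDerivWithinAt (fun t => ∫ s in Ioo 0 t, dphi T φ s • d s) 0 (Icc 0 T) t :=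
    (hasDerivWithinAt_const t (Icc 0 T) (0 : E)).congr_of_mem h ht
  have h3 := (uniqueDiffOn_Icc hT t ht).eq_deriv _ h1 h2
  exact (smul_eq_zero.1 h3).resolve_left (hφ.dphi_pos t ht).ne'

/-- A function with continuous modified derivative `d` satisfies `f - f(0) = I^α d`. -/
lemma IsTimeScale.sub_eq_rlIntegral (hφ : IsTimeScale T φ) (hT : 0 < T) {α : ℝ} (hα0 : 0 < α)
    (hα1 : α ≤ 1) {f d : ℝ → E} (hf : ContinuousOn f (Icc 0 T)) (hd : ContinuousOn d (Icc 0 T))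
    (h : ∀ t ∈ Ioc 0 T, HasCaputoDeriv T φ α f (d t) t) :
    ∀ t ∈ Icc 0 T, f t - f 0 = rlIntegral T φ α d t := by
  have hg : ContinuousOn (fun s => f s - f 0) (Icc 0 T) := hf.sub continuousOn_const
  have hGc : ContinuousOn (rlIntegral T φ (1 - α) fun s => f s - f 0) (Icc 0 T) := by
    rcases eq_or_lt_of_le hα1 with rfl | hlt
    · exact hg.congr fun t _ => by simp [rlIntegral]
    · exact hφ.continuousOn_rlIntegral hT (by linarith) hg
  have hG0 : rlIntegral T φ (1 - α) (fun s => f s - f 0) 0 = 0 := by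
    rcases eq_or_lt_of_le hα1 with rfl | hlt
    · simp [rlIntegral]
    · exact rlIntegral_zero_right (by linarith) _
  -- The equation integrated once: `I^{1-α}(f - f 0) = I^1 d`. Continuity up to `0` with value `0`
  -- there replaces a derivative at the initial time.
  have hG : ∀ t ∈ Icc 0 T, rlIntegral T φ (1 - α) (fun s => f s - f 0) t =
      ∫ s in Ioo 0 t, dphi T φ s • d s := by
    intro t ht
    have hsub : Icc 0 t ⊆ Icc 0 T := Icc_subset_Icc_right ht.2
    have hint : IntervalIntegrable (fun s => dphi T φ s • d s) volume 0 t := by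
      refine ContinuousOn.intervalIntegrable ?_
      rw [uIcc_of_le ht.1]
      exact ((hφ.continuousOn_dphi hT).smul hd).mono hsub
    have := intervalIntegral.integral_eq_sub_of_hasDerivAt_of_le ht.1 (hGc.mono hsub)
      (f' := fun s => dphi T φ s • d s) (fun s hs => ?_) hint
    · rw [hG0, sub_zero, intervalIntegral.integral_of_le ht.1, integral_Ioc_eq_integral_Ioo] at this
      exact this.symm
    · have hs' : s ∈ Ioc 0 T := ⟨hs.1, hs.2.le.trans ht.2⟩
      obtain ⟨h1, h2⟩ := h s hs'
      have h3 := h1.hasDerivWithinAt.hasDerivAt (Icc_mem_nhds hs.1 (hs.2.trans_le ht.2))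
      convert h3 using 1
      rw [← h2, rlDeriv, smul_inv_smul₀ (hφ.dphi_pos s ⟨hs'.1.le, hs'.2⟩).ne']
  -- For `α = 1` the inner integral has order `0` and is the identity by definition; the semigroup
  -- law covers only orders strictly between `0` and `1`.
  rcases eq_or_lt_of_le hα1 with rfl | hlt
  · intro t ht
    rw [rlIntegral_one ht.1, ← hG t ht]
    simp [rlIntegral]
  · have hb : 0 < 1 - α := by linarith
    have hId := hφ.continuousOn_rlIntegral hT hα0 hd
    have hIdn : ContinuousOn (fun s => (-1 : ℝ) • rlIntegral T φ α d s) (Icc 0 T) :=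
      hId.const_smul _
    obtain ⟨M, hM⟩ := isCompact_Icc.exists_bound_of_continuousOn hg
    obtain ⟨N, hN⟩ := isCompact_Icc.exists_bound_of_continuousOn hIdn
    -- `I^{1-α}` annihilates `f - f 0 - I^α d`, since `I^{1-α} I^α d = I^1 d`.
    have hz : ∀ t ∈ Icc 0 T, rlIntegral T φ (1 - α)
        (fun s => (f s - f 0) + (-1 : ℝ) • rlIntegral T φ α d s) t = 0 := by
      intro t ht
      have h5 := hφ.rlIntegral_rlIntegral hT hb (by linarith) hd ht
      rw [sub_sub_cancel] at h5
      rw [hφ.rlIntegral_add hb ht (hg.aestronglyMeasurable measurableSet_Icc)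
        (hIdn.aestronglyMeasurable measurableSet_Icc) hM hN, rlIntegral_smul hb.ne' ht.1, hG t ht,
        h5]
      simp
    intro t ht
    have := hφ.eqOn_zero_of_integral hT (hg.add hIdn) (fun t ht => ?_) t ht
    · simpa [sub_eq_zero, ← sub_eq_add_neg] using this
    -- Applying `I^α` once more shows that `I^1` of the difference vanishes, hence so does the
    -- difference.
    · have h6 := hφ.rlIntegral_rlIntegral hT hα0 hlt (hg.add hIdn) ht
      rw [← h6, rlIntegral_congr hα0.ne' ht.1 (g := fun _ => (0 : ℝ) • (0 : E)),
        rlIntegral_smul hα0.ne' ht.1, zero_smul]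
      intro s hs
      simp only [smul_zero]
      exact hz s ⟨hs.1.le, hs.2.le.trans ht.2⟩

/-- The fractional derivative is a left inverse of the fractional integral. -/
lemma IsTimeScale.rlDeriv_eq (hφ : IsTimeScale T φ) (hT : 0 < T) {α : ℝ} (hα0 : 0 < α)
    (hα1 : α ≤ 1) {f d : ℝ → E} (hd : ContinuousOn d (Icc 0 T))
    (h : ∀ t ∈ Ioc 0 T, f t = rlIntegral T φ α d t) {t : ℝ} (ht : t ∈ Ioc 0 T) :
    rlDeriv T φ α f t = d t := by
  have hG : ∀ t ∈ Ioc 0 T, rlIntegral T φ (1 - α) f t = ∫ s in Ioo 0 t, dphi T φ s • d s := by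
    intro t ht
    rcases eq_or_lt_of_le hα1 with rfl | hlt
    · rw [← rlIntegral_one ht.1.le, ← h t ht]
      simp [rlIntegral]
    · have hb : 0 < 1 - α := by linarith
      have h5 := hφ.rlIntegral_rlIntegral hT hb (by linarith) hd ⟨ht.1.le, ht.2⟩
      rw [sub_sub_cancel] at h5
      rw [← h5]
      exact rlIntegral_congr hb.ne' ht.1.le fun s hs => h s ⟨hs.1, hs.2.le.trans ht.2⟩
  have ht' : t ∈ Icc 0 T := ⟨ht.1.le, ht.2⟩
  have h1 := hφ.hasDerivWithinAt_integral hT hd ht'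
  have h2 : HasDerivWithinAt (rlIntegral T φ (1 - α) f) (dphi T φ t • d t) (Icc 0 T) t := by
    refine h1.congr_of_eventuallyEq ?_ (hG t ht)
    -- Nothing is known about `f 0`, and for `α = 1` it is the value of `I^0 f` at `0`. Positive
    -- times suffice, because `t > 0`.
    filter_upwards [self_mem_nhdsWithin, mem_nhdsWithin_of_mem_nhds (Ioi_mem_nhds ht.1)]
      with s hs hs'
    exact hG s ⟨hs', hs.2⟩
  rw [rlDeriv, h2.derivWithin (uniqueDiffOn_Icc hT t ht'),
    inv_smul_smul₀ (hφ.dphi_pos t ht').ne']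

end FractionalEquations

/-! ### Test functions, the Laplacian and plane waves -/

section Spatial

variable {n : ℕ}

lemma laplacian_eq_sum_fderiv {F : Type*} [NormedAddCommGroup F] [NormedSpace ℝ F]
    {f : Space n → F} (hf : ContDiff ℝ 2 f) (x : Space n) :
    Laplacian.laplacian f x = ∑ k, fderiv ℝ (fun y => fderiv ℝ f y (EuclideanSpace.single k 1)) x
      (EuclideanSpace.single k 1) := by
  rw [InnerProductSpace.laplacian_eq_iteratedFDeriv_orthonormalBasis f
    (EuclideanSpace.basisFun (Fin n) ℝ)]
  refine Finset.sum_congr rfl fun k _ => ?_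
  have hd : DifferentiableAt ℝ (fderiv ℝ f) x :=
    ((hf.fderiv_right (m := 1) (by norm_num)).differentiable one_ne_zero) x
  rw [iteratedFDeriv_two_apply, fderiv_clm_apply hd (differentiableAt_const _)]
  simp

lemma norm_laplacian_le {F : Type*} [NormedAddCommGroup F] [NormedSpace ℝ F]
    (f : Space n → F) (x : Space n) :
    ‖Laplacian.laplacian f x‖ ≤ n * ‖iteratedFDeriv ℝ 2 f x‖ := by
  rw [InnerProductSpace.laplacian_eq_iteratedFDeriv_orthonormalBasis f
    (EuclideanSpace.basisFun (Fin n) ℝ)]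
  refine (norm_sum_le _ _).trans ?_
  refine (Finset.sum_le_card_nsmul _ _ (‖iteratedFDeriv ℝ 2 f x‖) fun k _ => ?_).trans_eq (by simp)
  refine ((iteratedFDeriv ℝ 2 f x).le_opNorm _).trans_eq ?_
  simp [Fin.prod_univ_two]

lemma continuous_laplacian {F : Type*} [NormedAddCommGroup F] [NormedSpace ℝ F]
    {f : Space n → F} (hf : ContDiff ℝ 2 f) : Continuous (Laplacian.laplacian f) := by
  rw [InnerProductSpace.laplacian_eq_iteratedFDeriv_orthonormalBasis f
    (EuclideanSpace.basisFun (Fin n) ℝ)]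
  have := hf.continuous_iteratedFDeriv (m := 2) le_rfl
  fun_prop

lemma HasCompactSupport.laplacian {F : Type*} [NormedAddCommGroup F] [NormedSpace ℝ F]
    {f : Space n → F} (hf : HasCompactSupport f) : HasCompactSupport (Laplacian.laplacian f) := by
  refine (hf.iteratedFDeriv (𝕜 := ℝ) 2).mono' fun x hx => subset_tsupport _ ?_
  rw [Function.mem_support] at hx ⊢
  intro h
  have := norm_laplacian_le f x
  rw [h, norm_zero, mul_zero, norm_le_zero_iff] at this
  exact hx this

/-- Green's identity for a compactly supported function. -/
lemma integral_smul_laplacian {f : Space n → ℝ} {g : Space n → ℂ} (hf : ContDiff ℝ 2 f)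
    (hg : ContDiff ℝ 2 g) (hgs : HasCompactSupport g) :
    ∫ x, f x • Laplacian.laplacian g x = ∫ x, Laplacian.laplacian f x • g x := by
  have hf1 : ∀ v, ContDiff ℝ 1 fun y => fderiv ℝ f y v := fun v =>
    (hf.fderiv_right (m := 1) (by norm_num)).clm_apply contDiff_const
  have hg1 : ∀ v, ContDiff ℝ 1 fun y => fderiv ℝ g y v := fun v =>
    (hg.fderiv_right (m := 1) (by norm_num)).clm_apply contDiff_const
  have hgs1 : ∀ v, HasCompactSupport fun y => fderiv ℝ g y v := fun v => hgs.fderiv_apply ℝ v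
  have hgs2 : ∀ v, HasCompactSupport fun x => fderiv ℝ (fun y => fderiv ℝ g y v) x v := fun v =>
    (hgs1 v).fderiv_apply ℝ v
  have hg2 : ∀ v, Continuous fun x => fderiv ℝ (fun y => fderiv ℝ g y v) x v := fun v =>
    ((hg1 v).continuous_fderiv one_ne_zero).clm_apply continuous_const
  have hf2 : ∀ v, Continuous fun x => fderiv ℝ (fun y => fderiv ℝ f y v) x v := fun v =>
    ((hf1 v).continuous_fderiv one_ne_zero).clm_apply continuous_const
  have hint : ∀ {p : Space n → ℝ} {r : Space n → ℂ}, Continuous p → Continuous r →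
      HasCompactSupport r → Integrable fun x => p x • r x := fun hp hr hrs =>
    (hp.smul hr).integrable_of_hasCompactSupport hrs.smul_left
  have key : ∀ v, ∫ x, f x • fderiv ℝ (fun y => fderiv ℝ g y v) x v =
      ∫ x, fderiv ℝ (fun y => fderiv ℝ f y v) x v • g x := by
    intro v
    rw [integral_smul_fderiv_eq_neg_fderiv_smul_of_integrable
        (hint (hf1 v).continuous (hg1 v).continuous (hgs1 v))
        (hint hf.continuous (hg2 v) (hgs2 v))
        (hint hf.continuous (hg1 v).continuous (hgs1 v))
        (fun x _ => hf.differentiable two_ne_zero x)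
        (fun x _ => (hg1 v).differentiable one_ne_zero x),
      integral_smul_fderiv_eq_neg_fderiv_smul_of_integrable
        (hint (hf2 v) hg.continuous hgs)
        (hint (hf1 v).continuous (hg1 v).continuous (hgs1 v))
        (hint (hf1 v).continuous hg.continuous hgs)
        (fun x _ => (hf1 v).differentiable one_ne_zero x)
        (fun x _ => hg.differentiable two_ne_zero x), neg_neg]
  simp only [laplacian_eq_sum_fderiv hf, laplacian_eq_sum_fderiv hg, Finset.smul_sum,
    Finset.sum_smul]
  rw [integral_finsetSum _ fun k _ => hint hf.continuous (hg2 _) (hgs2 _),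
    integral_finsetSum _ fun k _ => hint (hf2 _) hg.continuous hgs]
  exact Finset.sum_congr rfl fun k _ => key _

/-- The derivatives of order at most two of `ψ` are bounded by `B`. -/
def BoundedC2 (B : ℝ) (ψ : Space n → ℝ) : Prop :=
  ∀ i ≤ 2, ∀ x, ‖iteratedFDeriv ℝ i ψ x‖ ≤ B

lemma BoundedC2.abs_le {B : ℝ} {ψ : Space n → ℝ} (h : BoundedC2 B ψ) (x : Space n) :
    |ψ x| ≤ B := by
  simpa using h 0 (by norm_num) x

lemma BoundedC2.abs_laplacian_le {B : ℝ} {ψ : Space n → ℝ} (h : BoundedC2 B ψ) (x : Space n) :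
    |Laplacian.laplacian ψ x| ≤ n * B :=
  (norm_laplacian_le ψ x).trans (mul_le_mul_of_nonneg_left (h 2 le_rfl x) (Nat.cast_nonneg _))

/-- Leibniz' rule; the binomial coefficients of order `i ≤ 2` sum to `2 ^ i ≤ 4`. -/
lemma BoundedC2.mul {B C : ℝ} {ψ χ : Space n → ℝ} (hψ : BoundedC2 B ψ) (hχ : BoundedC2 C χ)
    (hψc : ContDiff ℝ 2 ψ) (hχc : ContDiff ℝ 2 χ) :
    BoundedC2 (4 * (B * C)) fun x => ψ x * χ x := by
  have hB : 0 ≤ B := (norm_nonneg _).trans (hψ 0 (by norm_num) 0)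
  have hC : 0 ≤ C := (norm_nonneg _).trans (hχ 0 (by norm_num) 0)
  intro i hi x
  refine (norm_iteratedFDeriv_mul_le hψc hχc x (n := i) (by exact_mod_cast hi)).trans ?_
  calc _ ≤ ∑ j ∈ Finset.range (i + 1), (i.choose j : ℝ) * (B * C) := by
        refine Finset.sum_le_sum fun j hj => ?_
        rw [mul_assoc]
        have hj' := Finset.mem_range.1 hj
        exact mul_le_mul_of_nonneg_left (mul_le_mul (hψ j (by lia) x) (hχ _ (by lia) x)
          (norm_nonneg _) hB) (Nat.cast_nonneg _)
    _ = 2 ^ i * (B * C) := by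
        rw [← Finset.sum_mul, ← Nat.cast_sum, Nat.sum_range_choose]; push_cast; rfl
    _ ≤ 4 * (B * C) := by
        refine mul_le_mul_of_nonneg_right ?_ (mul_nonneg hB hC)
        calc (2 : ℝ) ^ i ≤ 2 ^ 2 := pow_le_pow_right₀ (by norm_num) hi
          _ = 4 := by norm_num

lemma norm_iteratedFDeriv_comp_clm_le {G : Type*} [NormedAddCommGroup G] [NormedSpace ℝ G]
    {f : G → ℝ} (hf : ContDiff ℝ 2 f) (ℓ : Space n →L[ℝ] G) {i : ℕ} (hi : i ≤ 2) (x : Space n) :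
    ‖iteratedFDeriv ℝ i (f ∘ ℓ) x‖ ≤ ‖iteratedFDeriv ℝ i f (ℓ x)‖ * ‖ℓ‖ ^ i := by
  rw [ℓ.iteratedFDeriv_comp_right hf x (by exact_mod_cast hi)]
  exact (ContinuousMultilinearMap.norm_compContinuousLinearMap_le _ _).trans_eq (by simp)

/-- Smooth cut-off functions exhausting the space, with uniformly bounded derivatives. -/
lemma exists_cutoff (n : ℕ) : ∃ (C : ℝ) (χ : ℕ → Space n → ℝ), (∀ k, IsTest (χ k)) ∧
    (∀ k, BoundedC2 C (χ k)) ∧ ∀ x, ∀ᶠ k in atTop, χ k =ᶠ[𝓝 x] fun _ => 1 := by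
  obtain ⟨b, hbr⟩ : ∃ b : ContDiffBump (0 : Space n), b.rIn = 1 :=
    ⟨⟨1, 2, one_pos, one_lt_two⟩, rfl⟩
  have hb : ContDiff ℝ (⊤ : ℕ∞) b := b.contDiff
  have hb2 : ContDiff ℝ 2 b := b.contDiff
  have hex : ∀ i : ℕ, ∃ C, ∀ x, ‖iteratedFDeriv ℝ i b x‖ ≤ C := fun i =>
    (b.hasCompactSupport.iteratedFDeriv i).exists_bound_of_continuous
      (hb.continuous_iteratedFDeriv (by exact_mod_cast le_top))
  choose C hC using hex
  -- The cut-offs are dilations of one bump by `k + 1 ≥ 1`; composing with a linear map of norm at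
  -- most `1` does not increase derivatives.
  obtain ⟨ℓ, hℓx⟩ : ∃ ℓ : ℕ → Space n →L[ℝ] Space n, ∀ k x, ℓ k x = ((k + 1 : ℝ)⁻¹) • x :=
    ⟨fun k => ((k + 1 : ℝ)⁻¹) • ContinuousLinearMap.id ℝ _, fun _ _ => rfl⟩
  have hk1 : ∀ k : ℕ, (0 : ℝ) < k + 1 := fun k => by positivity
  have hℓ : ∀ k, ‖ℓ k‖ ≤ 1 := fun k => by
    refine ContinuousLinearMap.opNorm_le_bound _ zero_le_one fun x => ?_
    rw [hℓx, norm_smul, norm_inv]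
    refine mul_le_mul_of_nonneg_right ?_ (norm_nonneg _)
    rw [Real.norm_of_nonneg (hk1 k).le]
    exact inv_le_one_of_one_le₀ (by linarith [(Nat.cast_nonneg k : (0 : ℝ) ≤ k)])
  refine ⟨max (C 0) (max (C 1) (C 2)), fun k => b ∘ ℓ k, fun k => ⟨hb.comp (ℓ k).contDiff, ?_⟩,
    fun k i hi x => ?_, fun x => ?_⟩
  · have e : b ∘ ℓ k = fun x => b ((k + 1 : ℝ)⁻¹ • x) := funext fun x => congrArg b (hℓx k x)
    change HasCompactSupport (b ∘ ℓ k)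
    rw [e]
    exact b.hasCompactSupport.comp_smul (inv_ne_zero (hk1 k).ne')
  · refine (norm_iteratedFDeriv_comp_clm_le hb2 (ℓ k) hi x).trans ?_
    refine (mul_le_of_le_one_right (norm_nonneg _) (pow_le_one₀ (norm_nonneg _) (hℓ k))).trans ?_
    refine (hC i _).trans ?_
    interval_cases i <;> simp
  · obtain ⟨N, hN⟩ := exists_nat_gt ‖x‖
    filter_upwards [eventually_ge_atTop N] with k hk
    have hx : x ∈ Metric.ball (0 : Space n) (k + 1) := by
      rw [mem_ball_zero_iff]
      have : (N : ℝ) ≤ k := by exact_mod_cast hk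
      linarith
    filter_upwards [Metric.isOpen_ball.mem_nhds hx] with y hy
    refine b.one_of_mem_closedBall ?_
    rw [mem_ball_zero_iff] at hy
    rw [mem_closedBall_zero_iff, hbr, hℓx, norm_smul, norm_inv, Real.norm_of_nonneg (hk1 k).le,
      inv_mul_le_iff₀ (hk1 k)]
    linarith

/-- The plane wave `x ↦ f ⟪ξ, x⟫`. -/
noncomputable def planeWave (f : ℝ → ℝ) (ξ : Space n) : Space n → ℝ := f ∘ innerSL ℝ ξ

lemma laplacian_planeWave {f : ℝ → ℝ} (hf : ContDiff ℝ 2 f) (ξ x : Space n) :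
    Laplacian.laplacian (planeWave f ξ) x = iteratedDeriv 2 f (inner ℝ ξ x) * ‖ξ‖ ^ 2 := by
  rw [InnerProductSpace.laplacian_eq_iteratedFDeriv_orthonormalBasis _
    (EuclideanSpace.basisFun (Fin n) ℝ), ← (EuclideanSpace.basisFun (Fin n) ℝ).sum_sq_inner_left,
    Finset.mul_sum]
  refine Finset.sum_congr rfl fun k _ => ?_
  rw [planeWave, (innerSL ℝ ξ).iteratedFDeriv_comp_right hf x le_rfl,
    ContinuousMultilinearMap.compContinuousLinearMap_apply,
    iteratedFDeriv_apply_eq_iteratedDeriv_mul_prod, Fin.prod_univ_two]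
  simp [mul_comm, sq]

lemma boundedC2_planeWave {f : ℝ → ℝ} (hf : ContDiff ℝ 2 f)
    (hb : ∀ i x, |iteratedDeriv i f x| ≤ 1) (ξ : Space n) :
    BoundedC2 (max 1 ‖ξ‖ ^ 2) (planeWave f ξ) := by
  intro i hi x
  refine (norm_iteratedFDeriv_comp_clm_le hf (innerSL ℝ ξ) hi x).trans ?_
  rw [norm_iteratedFDeriv_eq_norm_iteratedDeriv, innerSL_apply_norm]
  refine (mul_le_of_le_one_left (by positivity) (hb i _)).trans ?_
  calc ‖ξ‖ ^ i ≤ max 1 ‖ξ‖ ^ i := pow_le_pow_left₀ (norm_nonneg _) (le_max_right _ _) _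
    _ ≤ max 1 ‖ξ‖ ^ 2 := pow_le_pow_right₀ (le_max_left _ _) hi

end Spatial

/-! ### The scalar Cauchy problem -/

section Heat

variable {n : ℕ} {α T : ℝ} {φ Θ : ℝ → ℝ} {g : Space n → ℂ} {u : Space n → ℝ → ℂ}

lemma two_le_top : (2 : WithTop ℕ∞) ≤ ((⊤ : ℕ∞) : WithTop ℕ∞) := by
  have : ((2 : ℕ∞) : WithTop ℕ∞) ≤ ((⊤ : ℕ∞) : WithTop ℕ∞) := by exact_mod_cast le_top
  exact this

lemma IsTest.laplacian {ψ : Space n → ℝ} (hψ : IsTest ψ) :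
    Continuous (Laplacian.laplacian ψ) ∧ HasCompactSupport (Laplacian.laplacian ψ) :=
  ⟨continuous_laplacian (hψ.1.of_le two_le_top), hψ.2.laplacian⟩

lemma IsAdmissible.continuous (hu : IsAdmissible T u) {t : ℝ} (ht : t ∈ Icc 0 T) :
    Continuous fun x => u x t :=
  hu.1.comp_continuous (f := fun x : Space n => (x, t)) (by fun_prop) fun x => ⟨mem_univ x, ht⟩

lemma IsAdmissible.continuousOn_apply (hu : IsAdmissible T u) (x : Space n) :
    ContinuousOn (u x) (Icc 0 T) :=
  hu.1.comp (f := fun t : ℝ => (x, t)) (by fun_prop) fun t ht => ⟨mem_univ x, ht⟩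

lemma IsAdmissible.continuousOn_integral (hu : IsAdmissible T u) {ψ : Space n → ℝ}
    (hψ : Continuous ψ) (hs : HasCompactSupport ψ) :
    ContinuousOn (fun s => ∫ x, (ψ x : ℂ) * u x s) (Icc 0 T) := by
  refine continuousOn_integral_of_compact_support (k := tsupport ψ) hs ?_ fun t x _ hx => ?_
  · refine ContinuousOn.mul (by fun_prop) ?_
    exact hu.1.comp (f := fun p : ℝ × Space n => (p.2, p.1)) (by fun_prop)
      fun p hp => ⟨mem_univ _, hp.1⟩
  · simp [image_eq_zero_of_notMem_tsupport hx]

/-- Without compact support of `ψ`, continuity in time is not immediate; measurability, from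
Fubini's theorem, is all that the fractional integral needs. -/
lemma IsAdmissible.aestronglyMeasurable_integral (hu : IsAdmissible T u) {ψ : Space n → ℝ}
    (hψ : Continuous ψ) :
    AEStronglyMeasurable (fun s => ∫ x, (ψ x : ℂ) * u x s) (volume.restrict (Icc 0 T)) := by
  have hc : ContinuousOn (fun p : ℝ × Space n => (ψ p.2 : ℂ) * u p.2 p.1) (Icc 0 T ×ˢ univ) := by
    refine ContinuousOn.mul (by fun_prop) ?_
    exact hu.1.comp (f := fun p : ℝ × Space n => (p.2, p.1)) (by fun_prop)
      fun p hp => ⟨mem_univ _, hp.1⟩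
  have h := hc.aestronglyMeasurable (μ := volume.prod volume)
    (measurableSet_Icc.prod MeasurableSet.univ)
  rw [← Measure.prod_restrict, Measure.restrict_univ] at h
  exact h.integral_prod_right'

/-- The uniform `L¹` bound gives one constant for all times and all bounded `ψ`, so plane waves may
serve as test functions. -/
lemma IsAdmissible.exists_bound (hu : IsAdmissible T u) :
    ∃ M, ∀ (ψ : Space n → ℝ) (B : ℝ), (∀ x, |ψ x| ≤ B) → ∀ t ∈ Icc 0 T,
      ‖∫ x, (ψ x : ℂ) * u x t‖ ≤ B * M := by
  obtain ⟨-, hint, M, hM⟩ := hu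
  refine ⟨M, fun ψ B hB t ht => ?_⟩
  have hB0 : 0 ≤ B := (abs_nonneg _).trans (hB 0)
  refine le_trans ?_ (mul_le_mul_of_nonneg_left (hM t ht) hB0)
  rw [← integral_const_mul]
  refine norm_integral_le_of_norm_le ((hint t ht).norm.const_mul B) (ae_of_all _ fun x => ?_)
  rw [norm_mul, Complex.norm_real]
  exact mul_le_mul_of_nonneg_right (hB x) (norm_nonneg _)

/-- Bounded pointwise convergent sequences of test functions. -/
lemma IsAdmissible.tendsto_integral (hu : IsAdmissible T u) {ψ : ℕ → Space n → ℝ}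
    {ψ' : Space n → ℝ} {B : ℝ} (hc : ∀ k, Continuous (ψ k)) (hB : ∀ k x, |ψ k x| ≤ B)
    (hlim : ∀ x, ∀ᶠ k in atTop, ψ k x = ψ' x) {t : ℝ} (ht : t ∈ Icc 0 T) :
    Tendsto (fun k => ∫ x, (ψ k x : ℂ) * u x t) atTop (𝓝 (∫ x, (ψ' x : ℂ) * u x t)) := by
  refine tendsto_integral_of_dominated_convergence (fun x => B * ‖u x t‖)
    (fun k => ?_) ((hu.2.1 t ht).norm.const_mul B) (fun k => ae_of_all _ fun x => ?_)
    (ae_of_all _ fun x => ?_)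
  · have := hc k
    exact Continuous.aestronglyMeasurable (by fun_prop) |>.mul (hu.2.1 t ht).aestronglyMeasurable
  · rw [norm_mul, Complex.norm_real]
    exact mul_le_mul_of_nonneg_right (hB k x) (norm_nonneg _)
  · refine tendsto_const_nhds.congr' ?_
    filter_upwards [hlim x] with k hk
    rw [hk]

/-- The weak form of the Cauchy problem as a Volterra equation. -/
lemma SolvesHeat.volterra_of_isTest (hu : SolvesHeat α T φ Θ g u) (hα0 : 0 < α) (hα1 : α ≤ 1)
    (hT : 0 < T) (hφ : IsTimeScale T φ) (hΘ : ContinuousOn Θ (Icc 0 T)) {ψ : Space n → ℝ}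
    (hψ : IsTest ψ) {t : ℝ} (ht : t ∈ Icc 0 T) :
    (∫ x, (ψ x : ℂ) * u x t) - ∫ x, (ψ x : ℂ) * g x =
      rlIntegral T φ α (fun s => Θ s • ∫ x, ((Laplacian.laplacian ψ x : ℝ) : ℂ) * u x s) t := by
  have h := hφ.sub_eq_rlIntegral hT hα0 hα1
    (d := fun s => Θ s • ∫ x, ((Laplacian.laplacian ψ x : ℝ) : ℂ) * u x s)
    (hu.admissible.continuousOn_integral hψ.1.continuous hψ.2)
    (hΘ.smul (hu.admissible.continuousOn_integral hψ.laplacian.1 hψ.laplacian.2))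
    (fun t ht => by simpa [Complex.real_smul] using hu.equation ψ hψ t ht) t ht
  simpa only [hu.initial] using h

/-- The Volterra equation for test functions which are merely bounded. -/
lemma SolvesHeat.volterra_of_boundedC2 (hu : SolvesHeat α T φ Θ g u) (hα0 : 0 < α)
    (hα1 : α ≤ 1) (hT : 0 < T) (hφ : IsTimeScale T φ) (hΘ : ContinuousOn Θ (Icc 0 T))
    {ψ : Space n → ℝ} {B : ℝ} (hψ : ContDiff ℝ (⊤ : ℕ∞) ψ) (hB : BoundedC2 B ψ) {t : ℝ}
    (ht : t ∈ Icc 0 T) :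
    (∫ x, (ψ x : ℂ) * u x t) - ∫ x, (ψ x : ℂ) * g x =
      rlIntegral T φ α (fun s => Θ s • ∫ x, ((Laplacian.laplacian ψ x : ℝ) : ℂ) * u x s) t := by
  have h0 : (0 : ℝ) ∈ Icc 0 T := ⟨le_rfl, hT.le⟩
  obtain ⟨C, χ, hχ, hχB, hχ1⟩ := exists_cutoff n
  have htest : ∀ k, IsTest fun x => ψ x * χ k x := fun k => ⟨hψ.mul (hχ k).1, (hχ k).2.mul_left⟩
  have hbd : ∀ k, BoundedC2 (4 * (B * C)) fun x => ψ x * χ k x := fun k =>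
    hB.mul (hχB k) (hψ.of_le two_le_top) ((hχ k).1.of_le two_le_top)
  -- Equality holds on a neighbourhood of `x` and not just at `x`, so the Laplacians agree at `x`
  -- too.
  have hev : ∀ x, ∀ᶠ k in atTop, (fun y => ψ y * χ k y) =ᶠ[𝓝 x] ψ := fun x => by
    filter_upwards [hχ1 x] with k hk
    filter_upwards [hk] with y hy
    simp [hy]
  have hlim : ∀ s ∈ Icc 0 T, Tendsto (fun k => ∫ x, ((ψ x * χ k x : ℝ) : ℂ) * u x s) atTop
      (𝓝 (∫ x, (ψ x : ℂ) * u x s)) := fun s hs =>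
    hu.admissible.tendsto_integral (fun k => (htest k).1.continuous) (fun k => (hbd k).abs_le)
      (fun x => (hev x).mono fun k hk => hk.eq_of_nhds) hs
  have hlimΔ : ∀ s ∈ Icc 0 T, Tendsto
      (fun k => ∫ x, ((Laplacian.laplacian (fun y => ψ y * χ k y) x : ℝ) : ℂ) * u x s) atTop
      (𝓝 (∫ x, ((Laplacian.laplacian ψ x : ℝ) : ℂ) * u x s)) := fun s hs =>
    hu.admissible.tendsto_integral (fun k => (htest k).laplacian.1)
      (fun k => (hbd k).abs_laplacian_le)
      (fun x => (hev x).mono fun k hk => (InnerProductSpace.laplacian_congr_nhds hk).eq_of_nhds) hs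
  obtain ⟨M, hM⟩ := hu.admissible.exists_bound
  obtain ⟨N, hN⟩ := isCompact_Icc.exists_bound_of_continuousOn hΘ
  have hlhs := (hlim t ht).sub (hlim 0 h0)
  simp only [hu.initial] at hlhs
  refine tendsto_nhds_unique hlhs ?_
  simp only [hu.volterra_of_isTest hα0 hα1 hT hφ hΘ (htest _) ht]
  refine hφ.tendsto_rlIntegral hα0 ht (M := N * (n * (4 * (B * C)) * M)) (fun k => ?_)
    (fun k s hs => ?_) (fun s hs => (hlimΔ s hs).const_smul _)
  · exact (hΘ.aestronglyMeasurable measurableSet_Icc).smul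
      (hu.admissible.aestronglyMeasurable_integral (htest k).laplacian.1)
  · rw [norm_smul]
    exact mul_le_mul (hN s hs) (hM _ _ (hbd k).abs_laplacian_le s hs) (norm_nonneg _)
      ((norm_nonneg _).trans (hN s hs))

variable {w₁ : Space n → ℂ} {w v : Space n → ℝ → ℂ}

/-- Testing with an eigenfunction of the Laplacian. -/
lemma SolvesHeat.integral_eigenfunction (hw : SolvesHeat α T φ Θ w₁ w)
    (hv : SolvesHeat α T φ Θ (Laplacian.laplacian w₁) v) (hα0 : 0 < α)
    (hα1 : α ≤ 1) (hT : 0 < T) (hφ : IsTimeScale T φ) (hΘ : ContinuousOn Θ (Icc 0 T))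
    (hw₁ : ContDiff ℝ 2 w₁) (hw₁s : HasCompactSupport w₁)
    {ψ : Space n → ℝ} {B c : ℝ} (hψ : ContDiff ℝ (⊤ : ℕ∞) ψ) (hB : BoundedC2 B ψ)
    (hc : ∀ x, Laplacian.laplacian ψ x = c * ψ x) {t : ℝ} (ht : t ∈ Icc 0 T) :
    ∫ x, (ψ x : ℂ) * v x t = c * ∫ x, (ψ x : ℂ) * w x t := by
  have hΔ : ∀ (u : Space n → ℝ → ℂ) s, ∫ x, ((Laplacian.laplacian ψ x : ℝ) : ℂ) * u x s =
      c * ∫ x, (ψ x : ℂ) * u x s := fun u s => by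
    simp only [hc, Complex.ofReal_mul, mul_assoc]
    exact integral_const_mul _ _
  -- The initial values of `⟨ψ,v⟩` and `c⟨ψ,w⟩` coincide, which makes the Volterra equation below
  -- homogeneous.
  have hgreen : ∫ x, (ψ x : ℂ) * Laplacian.laplacian w₁ x = c * ∫ x, (ψ x : ℂ) * w₁ x := by
    have := integral_smul_laplacian (hψ.of_le two_le_top) hw₁ hw₁s
    simp only [Complex.real_smul, hc, Complex.ofReal_mul, mul_assoc] at this
    rw [this]
    exact integral_const_mul _ _
  obtain ⟨M, hM⟩ := hw.admissible.exists_bound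
  obtain ⟨M', hM'⟩ := hv.admissible.exists_bound
  obtain ⟨N, hN⟩ := isCompact_Icc.exists_bound_of_continuousOn hΘ
  have mw := hw.admissible.aestronglyMeasurable_integral hψ.continuous
  have mv := hv.admissible.aestronglyMeasurable_integral hψ.continuous
  have mΘ := hΘ.aestronglyMeasurable (μ := volume) measurableSet_Icc
  have ew := fun t ht => hw.volterra_of_boundedC2 hα0 hα1 hT hφ hΘ hψ hB (t := t) ht
  have ev := fun t ht => hv.volterra_of_boundedC2 hα0 hα1 hT hφ hΘ hψ hB (t := t) ht
  simp only [hΔ] at ew ev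
  have hbound : ∀ {u : Space n → ℝ → ℂ} {M : ℝ},
      (∀ (ψ : Space n → ℝ) (B : ℝ), (∀ x, |ψ x| ≤ B) → ∀ t ∈ Icc 0 T,
      ‖∫ x, (ψ x : ℂ) * u x t‖ ≤ B * M) → ∀ s ∈ Icc 0 T,
      ‖Θ s • ((c : ℂ) * ∫ x, (ψ x : ℂ) * u x s)‖ ≤ N * (|c| * (B * M)) := by
    intro u M hM s hs
    rw [norm_smul, norm_mul, Complex.norm_real]
    exact mul_le_mul (hN s hs) (mul_le_mul_of_nonneg_left (hM _ _ hB.abs_le s hs) (abs_nonneg c))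
      (by positivity) ((norm_nonneg _).trans (hN s hs))
  -- The function `y = ⟨ψ,v⟩ - c⟨ψ,w⟩` satisfies `y = I^α(c Θ y)`.
  have key := hφ.eq_zero_of_volterra hT hα0
    (y := fun t => (∫ x, (ψ x : ℂ) * v x t) + (-c : ℝ) • ∫ x, (ψ x : ℂ) * w x t)
    (c := fun s => Θ s * c) (M := B * M' + |c| * (B * M)) (N := N * |c|) ?_ ?_ ?_ t ht
  · rw [← sub_eq_zero, ← key]
    simp [Complex.real_smul, sub_eq_add_neg]
  · intro s hs
    refine (norm_add_le _ _).trans (add_le_add (hM' _ _ hB.abs_le s hs) ?_)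
    rw [norm_smul, norm_neg]
    exact mul_le_mul_of_nonneg_left (hM _ _ hB.abs_le s hs) (abs_nonneg c)
  · intro s hs
    rw [abs_mul]
    exact mul_le_mul_of_nonneg_right (hN s hs) (abs_nonneg c)
  · intro t ht
    have e : (fun s => (Θ s * c) •
        ((∫ x, (ψ x : ℂ) * v x s) + (-c : ℝ) • ∫ x, (ψ x : ℂ) * w x s)) = fun s =>
        Θ s • ((c : ℂ) * ∫ x, (ψ x : ℂ) * v x s) +
          (-c : ℝ) • (Θ s • ((c : ℂ) * ∫ x, (ψ x : ℂ) * w x s)) := by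
      ext s
      simp only [Complex.real_smul]
      push_cast
      ring
    rw [e, hφ.rlIntegral_add hα0 ht (f := fun s => Θ s • ((c : ℂ) * ∫ x, (ψ x : ℂ) * v x s))
      (g := fun s => (-c : ℝ) • (Θ s • ((c : ℂ) * ∫ x, (ψ x : ℂ) * w x s))) (mΘ.smul (mv.const_mul _))
      ((mΘ.smul (mw.const_mul _)).const_smul (-c : ℝ)) (hbound hM')
      (N := |c| * (N * (|c| * (B * M)))) (fun s hs => ?_),
      rlIntegral_smul hα0.ne' ht.1, ← ew t ht, ← ev t ht, hgreen]
    · simp only [Complex.real_smul]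
      push_cast
      ring
    · rw [norm_smul, norm_neg]
      exact mul_le_mul_of_nonneg_left (hbound hM s hs) (abs_nonneg c)

/-- The Fourier transforms of the two solutions differ by the symbol of the Laplacian. -/
lemma SolvesHeat.integral_exp (hw : SolvesHeat α T φ Θ w₁ w)
    (hv : SolvesHeat α T φ Θ (Laplacian.laplacian w₁) v) (hα0 : 0 < α)
    (hα1 : α ≤ 1) (hT : 0 < T) (hφ : IsTimeScale T φ) (hΘ : ContinuousOn Θ (Icc 0 T))
    (hw₁ : ContDiff ℝ 2 w₁) (hw₁s : HasCompactSupport w₁) (ξ : Space n) {t : ℝ}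
    (ht : t ∈ Icc 0 T) :
    ∫ x, Complex.exp (inner ℝ ξ x * Complex.I) * v x t =
      -(‖ξ‖ ^ 2 : ℝ) * ∫ x, Complex.exp (inner ℝ ξ x * Complex.I) * w x t := by
  -- Test functions are real, so the complex exponential is handled through its real and imaginary
  -- parts.
  have hcos := hw.integral_eigenfunction hv hα0 hα1 hT hφ hΘ hw₁ hw₁s (ψ := planeWave Real.cos ξ)
    (c := -‖ξ‖ ^ 2) (Real.contDiff_cos.comp (innerSL ℝ ξ).contDiff)
    (boundedC2_planeWave Real.contDiff_cos Real.abs_iteratedDeriv_cos_le_one ξ)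
    (fun x => by
      rw [laplacian_planeWave Real.contDiff_cos, planeWave]
      simp [iteratedDeriv_succ, mul_comm]) ht
  have hsin := hw.integral_eigenfunction hv hα0 hα1 hT hφ hΘ hw₁ hw₁s (ψ := planeWave Real.sin ξ)
    (c := -‖ξ‖ ^ 2) (Real.contDiff_sin.comp (innerSL ℝ ξ).contDiff)
    (boundedC2_planeWave Real.contDiff_sin Real.abs_iteratedDeriv_sin_le_one ξ)
    (fun x => by
      rw [laplacian_planeWave Real.contDiff_sin, planeWave]
      simp [iteratedDeriv_succ, mul_comm]) ht
  have hint : ∀ {u : Space n → ℝ → ℂ}, IsAdmissible T u → ∀ {f : ℝ → ℝ}, Continuous f →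
      (∀ x, |f x| ≤ 1) → Integrable fun x => (planeWave f ξ x : ℂ) * u x t := by
    intro u hu f hf hf1
    refine (hu.2.1 t ht).bdd_mul (c := 1) ?_ (ae_of_all _ fun x => ?_)
    · exact (Complex.continuous_ofReal.comp
        (hf.comp (innerSL ℝ ξ).continuous)).aestronglyMeasurable
    · rw [Complex.norm_real]; exact hf1 _
  have hexp : ∀ {u : Space n → ℝ → ℂ}, IsAdmissible T u →
      ∫ x, Complex.exp (inner ℝ ξ x * Complex.I) * u x t =
        (∫ x, (planeWave Real.cos ξ x : ℂ) * u x t) +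
          Complex.I * ∫ x, (planeWave Real.sin ξ x : ℂ) * u x t := by
    intro u hu
    rw [← integral_const_mul, ← integral_add
      (hint hu Real.continuous_cos Real.abs_cos_le_one)
      ((hint hu Real.continuous_sin Real.abs_sin_le_one).const_mul _)]
    refine integral_congr_ae (ae_of_all _ fun x => ?_)
    simp only [planeWave, Function.comp_apply, innerSL_apply_apply, Complex.exp_mul_I,
      Complex.ofReal_cos, Complex.ofReal_sin]
    ring
  rw [hexp hv.admissible, hexp hw.admissible, hcos, hsin]
  push_cast
  ring

end Heat

/-! ### Recovery of the diffusivity -/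

section Recovery

variable {n : ℕ}

-- Fubini's theorem moves the Fourier transform onto `a`. The factor `2π` translates between the
-- normalization `e^{2πi⟨ξ,x⟩}` and the plane waves `e^{i⟨ξ,x⟩}`.
open scoped FourierTransform SchwartzMap in
lemma integral_fourierInv_mul (g : 𝓢(Space n, ℂ)) {a : Space n → ℂ} (ha : Integrable a) :
    ∫ x, (𝓕⁻ g) x * a x =
      ∫ ξ, g ξ * ∫ x, Complex.exp (inner ℝ ((2 * Real.pi) • ξ) x * Complex.I) * a x := by
  have h := VectorFourier.integral_fourierIntegral_smul_eq_flip (L := -innerₗ (Space n))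
    (μ := volume) (ν := volume) (e := Real.fourierChar) Real.continuous_fourierChar
    (by simp; exact continuous_inner.neg) g.integrable ha
  have e1 : ∀ x, VectorFourier.fourierIntegral Real.fourierChar volume (-innerₗ (Space n)) g x =
      (𝓕⁻ g) x := fun x => by
    rw [SchwartzMap.fourierInv_coe, Real.fourierInv_eq]
    simp [VectorFourier.fourierIntegral]
  simp only [e1, smul_eq_mul] at h
  rw [h]
  refine integral_congr_ae (ae_of_all _ fun ξ => ?_)
  simp only [VectorFourier.fourierIntegral, Circle.smul_def, Real.fourierChar_apply, smul_eq_mul]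
  congr 1
  refine integral_congr_ae (ae_of_all _ fun x => ?_)
  have e : inner ℝ ((2 * Real.pi) • ξ) x = 2 * Real.pi * inner ℝ ξ x := real_inner_smul_left _ _ _
  simp only [e]
  simp

/-- If the Fourier transforms differ by the symbol of the Laplacian, then so do the functions, in
the sense of distributions. -/
lemma integral_mul_eq_of_integral_exp {a b : Space n → ℂ} (ha : Integrable a) (hb : Integrable b)
    (h : ∀ ξ : Space n, ∫ x, Complex.exp (inner ℝ ξ x * Complex.I) * a x =
      -(‖ξ‖ ^ 2 : ℝ) * ∫ x, Complex.exp (inner ℝ ξ x * Complex.I) * b x)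
    {ψ : Space n → ℝ} (hψ : IsTest ψ) :
    ∫ x, (ψ x : ℂ) * a x = ∫ x, ((Laplacian.laplacian ψ x : ℝ) : ℂ) * b x := by
  have hcs : HasCompactSupport fun x => (ψ x : ℂ) := hψ.2.comp_left (g := ((↑) : ℝ → ℂ)) (by simp)
  obtain ⟨f, hf⟩ : ∃ f : SchwartzMap (Space n) ℂ, ∀ x, f x = ψ x :=
    ⟨hcs.toSchwartzMap (Complex.ofRealCLM.contDiff.comp hψ.1), fun _ => rfl⟩
  have hΔ : ∀ x, (Laplacian.laplacian f) x = ((Laplacian.laplacian ψ x : ℝ) : ℂ) := fun x => by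
    have hf' : (f : Space n → ℂ) = Complex.ofRealCLM ∘ ψ := funext hf
    rw [SchwartzMap.laplacian_apply, hf',
      (hψ.1.of_le two_le_top).contDiffAt.laplacian_CLM_comp_left]
    rfl
  have e1 : ∫ x, (ψ x : ℂ) * a x = ∫ x, (FourierTransformInv.fourierInv
      (FourierTransform.fourier f)) x * a x := by
    simp only [FourierTransform.fourierInv_fourier_eq, hf]
  have e2 : ∫ x, ((Laplacian.laplacian ψ x : ℝ) : ℂ) * b x = -(2 * Real.pi) ^ 2 *
      ∫ x, (FourierTransformInv.fourierInv (SchwartzMap.smulLeftCLM ℂ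
        (fun x : Space n => ‖x‖ ^ 2) (FourierTransform.fourier f))) x * b x := by
    rw [← integral_const_mul]
    refine integral_congr_ae (ae_of_all _ fun x => ?_)
    simp only [← hΔ]
    rw [SchwartzMap.laplacian_eq_fourierMultiplierCLM, SchwartzMap.fourierMultiplierCLM_apply,
      ← mul_assoc]
    congr 1
    simp
  rw [e1, e2, integral_fourierInv_mul _ ha, integral_fourierInv_mul _ hb, ← integral_const_mul]
  refine integral_congr_ae (ae_of_all _ fun ξ => ?_)
  simp only
  -- The hypothesis is used at the frequency `2πξ`, where its symbol is the multiplier `-(2π)²‖ξ‖²`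
  -- of the Laplacian.
  rw [h, SchwartzMap.smulLeftCLM_apply_apply (by fun_prop), norm_smul,
    Real.norm_of_nonneg (by positivity), Complex.real_smul]
  push_cast
  ring

variable {α T : ℝ} {φ Θ : ℝ → ℝ} {w₁ : Space n → ℂ} {w v : Space n → ℝ → ℂ}

/-- Mollifiers at the point `q`. -/
lemma exists_mollifier (q : Space n) : ∃ ψ : ℕ → Space n → ℝ, (∀ k, IsTest (ψ k)) ∧
    (∀ k x, 0 ≤ ψ k x) ∧ (∀ k, ∫ x, ψ k x = 1) ∧
    (∀ k x, 1 ≤ ‖x - q‖ → ψ k x = 0) ∧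
    ∀ f : Space n → ℂ, Continuous f →
      Tendsto (fun k => ∫ x, (ψ k x : ℂ) * f x) atTop (𝓝 (f q)) := by
  have hk : ∀ k : ℕ, (0 : ℝ) < 1 / (k + 1 : ℝ) := fun k => by positivity
  obtain ⟨b, hb⟩ : ∃ b : ℕ → ContDiffBump (0 : Space n), ∀ k, (b k).rOut = 1 / (k + 1 : ℝ) :=
    ⟨fun k => ⟨1 / (k + 1 : ℝ) / 2, 1 / (k + 1 : ℝ), half_pos (hk k), half_lt_self (hk k)⟩,
      fun _ => rfl⟩
  have hcs : ∀ k, HasCompactSupport fun x => (b k).normed volume (q - x) := fun k =>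
    (b k).hasCompactSupport_normed.comp_homeomorph (Homeomorph.subLeft q)
  refine ⟨fun k x => (b k).normed volume (q - x), fun k => ⟨?_, hcs k⟩,
    fun k x => (b k).nonneg_normed _, fun k => ?_, fun k x hx => ?_, fun f hf => ?_⟩
  · exact (b k).contDiff_normed.comp (contDiff_const.sub contDiff_id)
  · rw [integral_sub_left_eq_self (fun x => (b k).normed volume x)]
    exact (b k).integral_normed
  · have : q - x ∉ Function.support ((b k).normed volume) := by
      rw [(b k).support_normed_eq, mem_ball_zero_iff, hb, ← norm_neg, neg_sub, not_lt]
      refine le_trans ?_ hx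
      rw [div_le_one (by positivity)]
      linarith [(Nat.cast_nonneg k : (0 : ℝ) ≤ k)]
    exact Function.notMem_support.1 this
  · have h := ContDiffBump.convolution_tendsto_right_of_continuous (φ := b) (l := atTop)
      (μ := (volume : Measure (Space n)))
      (by simpa only [hb] using tendsto_one_div_add_atTop_nhds_zero_nat) hf q
    refine h.congr fun k => ?_
    rw [convolution_lsmul_swap]
    simp only [Complex.real_smul]

/-- An average over the unit ball at `q` is bounded by the maximum of `u` on a compact set. This
dominates all mollified values at once, so the limit passes under the fractional integral. -/
lemma IsAdmissible.exists_bound_ball {u : Space n → ℝ → ℂ} (hu : IsAdmissible T u)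
    (q : Space n) : ∃ M, ∀ ψ : Space n → ℝ, IsTest ψ → (∀ x, 0 ≤ ψ x) → ∫ x, ψ x = 1 →
      (∀ x, 1 ≤ ‖x - q‖ → ψ x = 0) → ∀ t ∈ Icc 0 T, ‖∫ x, (ψ x : ℂ) * u x t‖ ≤ M := by
  obtain ⟨M, hM⟩ := ((isCompact_closedBall q 1).prod
    (isCompact_Icc (a := (0 : ℝ)) (b := T))).exists_bound_of_continuousOn
    (hu.1.mono (prod_mono (subset_univ _) subset_rfl))
  refine ⟨M, fun ψ hψ hψ0 hψ1 hψs t ht => ?_⟩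
  have hint : Integrable ψ := hψ.1.continuous.integrable_of_hasCompactSupport hψ.2
  have e : M = ∫ x, M * ψ x := by rw [integral_const_mul, hψ1, mul_one]
  rw [e]
  refine norm_integral_le_of_norm_le (hint.const_mul M) (ae_of_all _ fun x => ?_)
  rw [norm_mul, Complex.norm_real, Real.norm_of_nonneg (hψ0 x), mul_comm]
  rcases le_or_gt 1 ‖x - q‖ with h | h
  · simp [hψs x h]
  · exact mul_le_mul_of_nonneg_right
      (hM (x, t) ⟨mem_closedBall_iff_norm.2 h.le, ht⟩) (hψ0 x)

/-- The pointwise relation between the two solutions. -/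
lemma SolvesHeat.sub_eq_rlIntegral (hw : SolvesHeat α T φ Θ w₁ w)
    (hv : SolvesHeat α T φ Θ (Laplacian.laplacian w₁) v) (hα0 : 0 < α)
    (hα1 : α ≤ 1) (hT : 0 < T) (hφ : IsTimeScale T φ) (hΘ : ContinuousOn Θ (Icc 0 T))
    (hw₁ : ContDiff ℝ 2 w₁) (hw₁s : HasCompactSupport w₁) (q : Space n) {t : ℝ}
    (ht : t ∈ Icc 0 T) :
    w q t - w₁ q = rlIntegral T φ α (fun s => Θ s • v q s) t := by
  have h0 : (0 : ℝ) ∈ Icc 0 T := ⟨le_rfl, hT.le⟩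
  obtain ⟨ψ, hψ, hψ0, hψ1, hψs, hψl⟩ := exists_mollifier q
  -- This is `v = Δw` in the sense of distributions.
  have hdual : ∀ k, ∀ s ∈ Icc 0 T, ∫ x, ((Laplacian.laplacian (ψ k) x : ℝ) : ℂ) * w x s =
      ∫ x, (ψ k x : ℂ) * v x s := fun k s hs =>
    (integral_mul_eq_of_integral_exp (hv.admissible.2.1 s hs) (hw.admissible.2.1 s hs)
      (fun ξ => hw.integral_exp hv hα0 hα1 hT hφ hΘ hw₁ hw₁s ξ hs) (hψ k)).symm
  have hk : ∀ k, (∫ x, (ψ k x : ℂ) * w x t) - ∫ x, (ψ k x : ℂ) * w₁ x =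
      rlIntegral T φ α (fun s => Θ s • ∫ x, (ψ k x : ℂ) * v x s) t := fun k => by
    rw [hw.volterra_of_isTest hα0 hα1 hT hφ hΘ (hψ k) ht]
    refine rlIntegral_congr hα0.ne' ht.1 fun s hs => ?_
    rw [hdual k s ⟨hs.1.le, hs.2.le.trans ht.2⟩]
  obtain ⟨M, hM⟩ := hv.admissible.exists_bound_ball q
  obtain ⟨N, hN⟩ := isCompact_Icc.exists_bound_of_continuousOn hΘ
  have hlhs := (hψl _ (hw.admissible.continuous ht)).sub (hψl _ hw₁.continuous)
  refine tendsto_nhds_unique hlhs ?_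
  simp only [hk]
  refine hφ.tendsto_rlIntegral hα0 ht (M := N * M) (fun k => ?_) (fun k s hs => ?_)
    (fun s hs => (hψl _ (hv.admissible.continuous hs)).const_smul _)
  · exact (hΘ.aestronglyMeasurable measurableSet_Icc).smul
      (hv.admissible.aestronglyMeasurable_integral (hψ k).1.continuous)
  · rw [norm_smul]
    exact mul_le_mul (hN s hs) (hM _ (hψ k) (hψ0 k) (hψ1 k) (hψs k) s hs) (norm_nonneg _)
      ((norm_nonneg _).trans (hN s hs))

/-- Recovery of the diffusivity from the scalar observations. -/
lemma SolvesHeat.recovery (hw : SolvesHeat α T φ Θ w₁ w)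
    (hv : SolvesHeat α T φ Θ (Laplacian.laplacian w₁) v) (hα0 : 0 < α)
    (hα1 : α ≤ 1) (hT : 0 < T) (hφ : IsTimeScale T φ) (hΘ : ContinuousOn Θ (Icc 0 T))
    (hw₁ : ContDiff ℝ 2 w₁) (hw₁s : HasCompactSupport w₁) (q : Space n) {h₁ h₂ : ℝ → ℂ}
    (hK : ∃ K : ℝ, 0 < K ∧ ∀ t ∈ Ioc 0 T, (K : ℂ) ≤ rlDeriv T φ α h₁ t / h₂ t)
    (ho₁ : ∀ t ∈ Ioc 0 T, w q t - w₁ q = h₁ t) (ho₂ : ∀ t ∈ Ioc 0 T, v q t = h₂ t) :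
    ∀ t ∈ Ioc 0 T, (Θ t : ℂ) = rlDeriv T φ α h₁ t / h₂ t := by
  intro t ht
  have hd : rlDeriv T φ α h₁ t = Θ t • v q t :=
    hφ.rlDeriv_eq hT hα0 hα1 (d := fun s => Θ s • v q s)
      (hΘ.smul (hv.admissible.continuousOn_apply q)) (fun s hs => by
        rw [← ho₁ s hs]
        exact hw.sub_eq_rlIntegral hv hα0 hα1 hT hφ hΘ hw₁ hw₁s q ⟨hs.1.le, hs.2⟩) ht
  -- Division by zero gives `0`, which is not at least `K > 0`; this also covers `t = T`.
  have hne : h₂ t ≠ 0 := by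
    obtain ⟨K, hK0, hK⟩ := hK
    intro h
    have h' := hK t ht
    rw [h, div_zero] at h'
    have : K ≤ 0 := by exact_mod_cast h'
    linarith
  rw [hd, ho₂ t ht, Complex.real_smul, mul_div_cancel_right₀ _ hne]

end Recovery

/-! ### The Witt basis -/

section Clifford

variable {n : ℕ}

lemma wittForm_apply (v : Fin n ⊕ Fin 2 → ℂ) : wittForm n v =
    ∑ k, Sum.elim (fun _ : Fin n => (-1 : ℂ)) ![1, -1] k * (v k * v k) := by
  simp [wittForm, QuadraticMap.weightedSumSquares_apply]

lemma cliffGen_mul_self (i : Fin n ⊕ Fin 2) :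
    cliffGen n i * cliffGen n i =
      algebraMap ℂ (Cliff n) (Sum.elim (fun _ : Fin n => (-1 : ℂ)) ![1, -1] i) := by
  rw [cliffGen, CliffordAlgebra.ι_sq_scalar, wittForm_apply,
    Finset.sum_eq_single i (fun j _ hj => by simp [Pi.single_eq_of_ne hj])
      (fun h => absurd (Finset.mem_univ i) h)]
  simp

lemma cliffGen_mul_cliffGen {i j : Fin n ⊕ Fin 2} (h : i ≠ j) :
    cliffGen n i * cliffGen n j = -(cliffGen n j * cliffGen n i) := by
  refine eq_neg_of_add_eq_zero_left ?_
  rw [cliffGen, cliffGen, CliffordAlgebra.ι_mul_ι_add_swap, QuadraticMap.polar]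
  rw [wittForm_apply, wittForm_apply, wittForm_apply, ← Finset.sum_sub_distrib, ← Finset.sum_sub_distrib, Finset.sum_eq_zero, map_zero]
  intro k _
  by_cases hi : k = i
  · subst hi; simp [Pi.single_eq_of_ne h]
  · simp [Pi.single_eq_of_ne hi]

lemma cliffE_mul_self (k : Fin n) : (cliffE k * cliffE k : Cliff n) = -1 := by
  rw [cliffE, cliffGen_mul_self]; simp

lemma cliffE_mul_cliffE {j k : Fin n} (h : j ≠ k) :
    (cliffE j * cliffE k : Cliff n) = -(cliffE k * cliffE j) :=
  cliffGen_mul_cliffGen (by simpa using h)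

lemma wittF_mul_cliffE (k : Fin n) : wittF n * cliffE k = -(cliffE k * wittF n) := by
  simp only [wittF, cliffE, smul_mul_assoc, mul_smul_comm, sub_mul, mul_sub]
  rw [cliffGen_mul_cliffGen (i := Sum.inr 0) (j := Sum.inl k) (by simp),
    cliffGen_mul_cliffGen (i := Sum.inr 1) (j := Sum.inl k) (by simp), ← smul_neg]
  congr 1; abel

lemma wittFplus_mul_cliffE (k : Fin n) :
    wittFplus n * cliffE k = -(cliffE k * wittFplus n) := by
  simp only [wittFplus, cliffE, smul_mul_assoc, mul_smul_comm, add_mul, mul_add]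
  rw [cliffGen_mul_cliffGen (i := Sum.inr 0) (j := Sum.inl k) (by simp),
    cliffGen_mul_cliffGen (i := Sum.inr 1) (j := Sum.inl k) (by simp), ← smul_neg]
  congr 1; abel

lemma cliffGen_plus_sq : cliffGen n (Sum.inr 0) * cliffGen n (Sum.inr 0) = 1 := by
  rw [cliffGen_mul_self]; simp

lemma cliffGen_minus_sq : cliffGen n (Sum.inr 1) * cliffGen n (Sum.inr 1) = -1 := by
  rw [cliffGen_mul_self]; simp

lemma cliffGen_plus_mul_minus : cliffGen n (Sum.inr 0) * cliffGen n (Sum.inr 1) =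
    -(cliffGen n (Sum.inr 1) * cliffGen n (Sum.inr 0)) :=
  cliffGen_mul_cliffGen (by simp)

lemma wittF_mul_self (n : ℕ) : wittF n * wittF n = 0 := by
  simp only [wittF, smul_mul_assoc, mul_smul_comm, sub_mul, mul_sub, cliffGen_plus_sq,
    cliffGen_minus_sq, cliffGen_plus_mul_minus]
  module

lemma wittFplus_mul_self (n : ℕ) : wittFplus n * wittFplus n = 0 := by
  simp only [wittFplus, smul_mul_assoc, mul_smul_comm, add_mul, mul_add, cliffGen_plus_sq,
    cliffGen_minus_sq, cliffGen_plus_mul_minus]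
  simp

lemma wittF_mul_wittFplus_add (n : ℕ) : wittF n * wittFplus n + wittFplus n * wittF n = 1 := by
  simp only [wittF, wittFplus, smul_mul_assoc, mul_smul_comm, sub_mul, mul_sub, add_mul, mul_add,
    cliffGen_plus_sq, cliffGen_minus_sq, cliffGen_plus_mul_minus]
  module

/-- Multiply `𝔣𝔣⁺ + 𝔣⁺𝔣 = 1` on the left by `𝔣` and use `𝔣² = 0`. -/
lemma wittF_mul_wittFplus_mul_wittF (n : ℕ) : wittF n * wittFplus n * wittF n = wittF n := by
  have h := congrArg (wittF n * ·) (wittF_mul_wittFplus_add n)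
  simpa only [mul_add, ← mul_assoc, wittF_mul_self, zero_mul, zero_add, mul_one] using h

lemma wittF_ne_zero (n : ℕ) : wittF n ≠ 0 := fun h => by
  have := wittF_mul_wittFplus_add n
  rw [h, zero_mul, mul_zero, add_zero] at this
  exact zero_ne_one this

/-- One such component is enough: the initial data and the observations of `𝔣W` and `𝔣V` are all
scalar multiples of `𝔣`. -/
lemma exists_functional_wittF (n : ℕ) : ∃ ℓ : Cliff n →ₗ[ℂ] ℂ, ℓ (wittF n) = 1 :=
  Module.Projective.exists_dual_eq_one ℂ (wittF_ne_zero n)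

end Clifford

/-! ### From the Dirac type problem to the scalar one -/

section Dirac

variable {n : ℕ} {α T : ℝ} {φ Θ : ℝ → ℝ} {g : Space n → ℂ} {W : Space n → ℝ → Cliff n}

lemma IsTest.partialDeriv {ψ : Space n → ℝ} (hψ : IsTest ψ) (k : Fin n) :
    IsTest (partialDeriv k ψ) :=
  ⟨(hψ.1.fderiv_right (m := (⊤ : ℕ∞)) (by simp)).clm_apply contDiff_const,
    hψ.2.fderiv_apply ℝ _⟩

lemma partialDeriv_comm {ψ : Space n → ℝ} (hψ : IsTest ψ) (j k : Fin n) (x : Space n) :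
    partialDeriv j (partialDeriv k ψ) x = partialDeriv k (partialDeriv j ψ) x := by
  have hd : DifferentiableAt ℝ (fderiv ℝ ψ) x :=
    ((hψ.1.fderiv_right (m := (⊤ : ℕ∞)) (by simp)).differentiable (by simp)) x
  have hs : IsSymmSndFDerivAt ℝ ψ x :=
    (hψ.1.of_le two_le_top).contDiffAt.isSymmSndFDerivAt (by simp)
  have e : ∀ i m : Fin n, partialDeriv i (partialDeriv m ψ) x =
      fderiv ℝ (fderiv ℝ ψ) x (EuclideanSpace.single i 1) (EuclideanSpace.single m 1) := by
    intro i m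
    unfold partialDeriv
    rw [fderiv_clm_apply hd (differentiableAt_const _)]
    simp
  rw [e, e]
  exact hs _ _

lemma rlDeriv_zero (t : ℝ) : rlDeriv T φ α (fun _ => (0 : ℂ)) t = 0 := by
  have : rlIntegral T φ (1 - α) (fun _ => (0 : ℂ)) = fun _ => 0 := by
    ext t; simp [rlIntegral]
  simp [rlDeriv, this]

/-- Every component of `𝔣 W` solves the transformed Cauchy problem. -/
lemma SolvesDirac.solvesHeat (hW : SolvesDirac α T φ Θ g W) (hΘpos : ∀ t ∈ Ioc 0 T, 0 < Θ t)
    {ℓ : Cliff n →ₗ[ℂ] ℂ} (hℓ : ℓ (wittF n) = 1) :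
    SolvesHeat α T φ Θ g (fun x t => ℓ (wittF n * W x t)) where
  admissible := hW.admissible ℓ
  initial x := by rw [hW.initial, map_smul, hℓ, smul_eq_mul, mul_one]
  equation ψ hψ t ht := by
    have ht' : t ∈ Icc 0 T := ⟨ht.1.le, ht.2⟩
    -- Left multiplication by `𝔣𝔣⁺` kills the `𝔣⁺` term, keeps the time derivative of `𝔣W`, and
    -- commutes with every `e_k`.
    obtain ⟨d, hd, hd'⟩ := hW.equation
      (ℓ ∘ₗ LinearMap.mulLeft ℂ (wittF n * wittFplus n)) ψ hψ t ht
    simp only [LinearMap.comp_apply, LinearMap.mulLeft_apply, ← mul_assoc,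
      wittF_mul_wittFplus_mul_wittF] at hd hd'
    have hff : wittF n * wittFplus n * wittFplus n = 0 := by
      rw [mul_assoc, wittFplus_mul_self, mul_zero]
    have hfe : ∀ k, wittF n * wittFplus n * cliffE k = cliffE k * wittF n * wittFplus n :=
      fun k => by
        rw [mul_assoc, wittFplus_mul_cliffE, mul_neg, ← mul_assoc, wittF_mul_cliffE, neg_mul,
          neg_neg]
    simp only [hff, hfe, zero_mul, map_zero, mul_zero, integral_zero, add_zero] at hd'
    have hk : ∀ k : Fin n,
        ∫ x, (partialDeriv k ψ x : ℂ) * ℓ (cliffE k * wittF n * wittFplus n * W x t) =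
        (Real.sqrt (Θ t) : ℂ) * ∑ j, ∫ x, (partialDeriv j (partialDeriv k ψ) x : ℂ) *
          ℓ (cliffE k * wittF n * cliffE j * W x t) := by
      intro k
      -- Left multiplication by `e_k𝔣` kills the time derivative, since `𝔣² = 0`. What remains
      -- expresses `e_k𝔣𝔣⁺W` through first derivatives of `W`, tested with `∂_kψ`.
      obtain ⟨d', hc, hc'⟩ := hW.equation
        (ℓ ∘ₗ LinearMap.mulLeft ℂ (cliffE k * wittF n)) _ (hψ.partialDeriv k) t ht
      simp only [LinearMap.comp_apply, LinearMap.mulLeft_apply, ← mul_assoc] at hc hc'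
      have hz : cliffE k * wittF n * wittF n = 0 := by rw [mul_assoc, wittF_mul_self, mul_zero]
      simp only [hz, zero_mul, map_zero, mul_zero, integral_zero] at hc
      have hd0 : d' = 0 := by
        rw [← hc.2]
        simpa using rlDeriv_zero t
      rw [hd0, add_zero] at hc'
      linear_combination hc'
    have hswap : ∀ k j : Fin n, cliffE k * wittF n * cliffE j =
        -(cliffE k * cliffE j * wittF n : Cliff n) := fun k j => by
      rw [mul_assoc, wittF_mul_cliffE, mul_neg, ← mul_assoc]
    let S : Fin n → Fin n → ℂ := fun k j => ∫ x, (partialDeriv j (partialDeriv k ψ) x : ℂ) *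
      ℓ (cliffE k * wittF n * cliffE j * W x t)
    -- The second derivatives of `ψ` are symmetric while `e_k e_j` is antisymmetric, so only the
    -- diagonal survives; there `e_k𝔣e_k = -e_k²𝔣 = 𝔣`.
    have hanti : ∀ k j, k ≠ j → S k j = -S j k := by
      intro k j hkj
      simp only [S]
      rw [← integral_neg]
      refine integral_congr_ae (ae_of_all _ fun x => ?_)
      simp only
      rw [hswap, hswap, cliffE_mul_cliffE hkj, partialDeriv_comm hψ]
      simp
    have hdiag : ∀ k, S k k = ∫ x, (partialDeriv k (partialDeriv k ψ) x : ℂ) *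
        ℓ (wittF n * W x t) := by
      intro k
      simp only [S, hswap, cliffE_mul_self, neg_mul, one_mul, neg_neg]
    have hsum : ∑ k, ∑ j, S k j = ∑ k, S k k := by
      -- The off-diagonal part equals its own negative after exchanging the two indices.
      have h1 : ∑ k, ∑ j, (S k j - if k = j then S k k else 0) = 0 := by
        have h2 : ∑ k, ∑ j, (S k j - if k = j then S k k else 0) =
            -∑ k, ∑ j, (S k j - if k = j then S k k else 0) := by
          conv_lhs => rw [Finset.sum_comm]
          rw [← Finset.sum_neg_distrib]
          refine Finset.sum_congr rfl fun k _ => ?_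
          rw [← Finset.sum_neg_distrib]
          refine Finset.sum_congr rfl fun j _ => ?_
          by_cases h : k = j
          · subst h; simp
          · rw [if_neg h, if_neg (Ne.symm h), hanti j k (Ne.symm h)]; ring
        exact self_eq_neg.1 h2
      simpa [Finset.sum_sub_distrib, sub_eq_zero] using h1
    have hlap : ∑ k, S k k = ∫ x, ((Laplacian.laplacian ψ x : ℝ) : ℂ) * ℓ (wittF n * W x t) := by
      simp only [hdiag]
      rw [← integral_finsetSum]
      · refine integral_congr_ae (ae_of_all _ fun x => ?_)
        simp only
        rw [laplacian_eq_sum_fderiv (hψ.1.of_le two_le_top), Complex.ofReal_sum, Finset.sum_mul]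
        rfl
      · intro k _
        have hp := (hψ.partialDeriv k).partialDeriv k
        have hp' := hp.1.continuous
        refine Continuous.integrable_of_hasCompactSupport
          (Continuous.mul (by fun_prop) ((hW.admissible ℓ).continuous ht')) ?_
        exact (hp.2.comp_left (g := ((↑) : ℝ → ℂ)) (by simp)).mul_right
    have hdval : d = (Θ t : ℂ) *
        ∫ x, ((Laplacian.laplacian ψ x : ℝ) : ℂ) * ℓ (wittF n * W x t) := by
      have hsq : (Real.sqrt (Θ t) : ℂ) * (Real.sqrt (Θ t) : ℂ) = Θ t := by
        rw [← Complex.ofReal_mul, Real.mul_self_sqrt (hΘpos t ht).le]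
      rw [← hlap, ← hsum, ← hsq, mul_assoc, Finset.mul_sum]
      simp only [hk] at hd'
      linear_combination hd'
    rw [← hdval]
    exact hd

end Dirac

theorem mainTheorem6 (n : ℕ) (α T : ℝ) (hα0 : 0 < α) (hα1 : α ≤ 1) (hT : 0 < T)
    (φ : ℝ → ℝ) (hφ : IsTimeScale T φ)
    (Θ : ℝ → ℝ) (hΘ : ContinuousOn Θ (Icc 0 T)) (hΘpos : ∀ t ∈ Ioc 0 T, 0 < Θ t)
    (Ω : Set (Space n)) (hΩ : IsOpen Ω) (hΩb : Bornology.IsBounded Ω)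
    (q : Space n) (hq : q ∈ Ω)
    (w₁ : Space n → ℂ) (h₁ h₂ : ℝ → ℂ)
    -- (1) the smallness condition
    (hsmall : ∃ ν C : ℝ, 0 < ν ∧ 0 < C ∧ C < 1 ∧ ∀ t ∈ Icc 0 T,
      sSup ((fun s => |Θ s|) '' Icc 0 T) * rlIntegral T φ α (fun s => Real.exp (ν * s)) t
        ≤ C * Real.exp (ν * t))
    -- (2) the initial datum
    (hw₁ : ContDiffOn ℝ 2 w₁ Ω) (hw₁' : ContDiffOn ℝ 1 w₁ (closure Ω))
    (hw₁supp : tsupport w₁ ⊆ Ω)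
    -- (3) the second observation
    (hh₂ : ContDiffOn ℝ 1 h₂ (Icc 0 T)) (hh₂ne : ∀ t ∈ Ioo 0 T, h₂ t ≠ 0)
    -- (4) the lower bound (the quotient is real and at least `K`)
    (hK : ∃ K : ℝ, 0 < K ∧ ∀ t ∈ Ioc 0 T, (K : ℂ) ≤ rlDeriv T φ α h₁ t / h₂ t) :
    -- observations of the solutions of the two Dirac type Cauchy problems
    (∀ W V : Space n → ℝ → Cliff n,
      SolvesDirac α T φ Θ w₁ W →
      SolvesDirac α T φ Θ (Laplacian.laplacian w₁) V →
      (∀ t ∈ Ioc 0 T, wittF n * W q t - w₁ q • wittF n = h₁ t • wittF n) →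
      (∀ t ∈ Ioc 0 T, wittF n * V q t = h₂ t • wittF n) →
      ∀ t ∈ Ioc 0 T, (Θ t : ℂ) = rlDeriv T φ α h₁ t / h₂ t) ∧
    -- observations of the scalar solutions of the two transformed Cauchy problems
    (∀ w v : Space n → ℝ → ℂ,
      SolvesHeat α T φ Θ w₁ w →
      SolvesHeat α T φ Θ (Laplacian.laplacian w₁) v →
      (∀ t ∈ Ioc 0 T, w q t - w₁ q = h₁ t) →
      (∀ t ∈ Ioc 0 T, v q t = h₂ t) →
      ∀ t ∈ Ioc 0 T, (Θ t : ℂ) = rlDeriv T φ α h₁ t / h₂ t) := by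
  -- The support lies in the open set `Ω`, where `w₁` is `C²`; off the support `w₁` is locally zero.
  -- So `w₁` is `C²` on the whole space.
  have hw₁2 : ContDiff ℝ 2 w₁ := by
    refine contDiff_iff_contDiffAt.2 fun x => ?_
    by_cases hx : x ∈ tsupport w₁
    · exact hw₁.contDiffAt (hΩ.mem_nhds (hw₁supp hx))
    · exact contDiffAt_const.congr_of_eventuallyEq (notMem_tsupport_iff_eventuallyEq.1 hx)
  have hw₁s : HasCompactSupport w₁ :=
    Metric.isCompact_of_isClosed_isBounded (isClosed_tsupport w₁) (hΩb.subset hw₁supp)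
  refine ⟨fun W V hW hV hoW hoV => ?_, fun w v hw hv ho₁ ho₂ =>
    hw.recovery hv hα0 hα1 hT hφ hΘ hw₁2 hw₁s q hK ho₁ ho₂⟩
  obtain ⟨ℓ, hℓ⟩ := exists_functional_wittF n
  refine (hW.solvesHeat hΘpos hℓ).recovery (hV.solvesHeat hΘpos hℓ) hα0 hα1 hT hφ hΘ hw₁2 hw₁s q
    hK (fun t ht => ?_) (fun t ht => ?_)
  · simpa [hℓ] using congrArg ℓ (hoW t ht)
  · simpa [hℓ] using congrArg ℓ (hoV t ht)
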